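/- **Conventions.** Let $S=\mathbb{C}[x_0,\dots,x_n]$. A closed subscheme $Y\subseteq\mathbb{P}^n$ (over $\mathbb{C}$; not necessarily reduced or irreducible) has the saturated homogeneous ideal $I_Y=\bigoplus_m H^0(\mathbb{P}^n,\mathscr{I}_Y(m))\subseteq S$. It is *ACM* if its homogeneous coordinate ring $S/I_Y$ is Cohen–Macaulay, and a *complete intersection* if $I_Y$ is generated by $\operatorname{codim}(Y,\mathbb{P}^n)$ homogeneous elements. A *minimal generator* of $I_Y$ is an element of some set of homogeneous generators of $I_Y$ from which no element can be left out. We say that $Y$ has the minimal free resolution $0\to\bigoplus_j\mathcal{O}_{\mathbb{P}^n}(-\beta_j)\to\bigoplus_i\mathcal{O}_{\mathbb{P}^n}(-\alpha_i)\to\mathscr{I}_Y\to0$ if $I_Y$ has a minimal graded free resolution $0\to\bigoplus_j S(-\beta_j)\to\bigoplus_i S(-\alpha_i)\to I_Y\to 0$ (minimal: the matrix of the first map has all its entries in $(x_0,\dots,x_n)$). A *weak admissible pair* of length $t\ge 2$ is a pair $(\hat a,\hat b)$ of integer sequences $a_1\le\dots\le a_t$, $b_1\le\dots\le b_t$ with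 $a_i<b_i$ for all $i$. Two such pairs $(\hat a,\hat b)$, $(\hat a',\hat b')$ of the same length are *equivalent* if there is $k\in\mathbb{Z}$ with $a'_i=a_i+k$ and $b'_i=b_i+k$ for all $i$. A hypersurface $X=V(F)\subset\mathbb{P}^n$ is *weak determinantal of type $(\hat a,\hat b)$* if $F=\det(m_{ij})$ for a $t\times t$ matrix of homogeneous polynomials $m_{ij}\in S$ with $\deg m_{ij}=b_j-a_i$ (the zero polynomial being allowed), where $m_{ij}=0$ whenever $a_i\ge b_j$. It is *weak determinantal* if it is so of some type. **Theorem.** Let $X=V(F)$ be a hypersurface of degree $d$ in $\mathbb{P}^n$ ($F\in S$ nonzero and homogeneous of degree $d$), and let $Y\subseteq X$ be a closed subscheme of codimension one in $X$. Let $\{(\hat a^{(j)},\hat b^{(j)})\}_{j\in I}$ be any family of weak admissible pairs that gives exactly the types of $X$ up to equivalence: $X$ is weak determinantal of type $(\hat a,\hat b)$ if and only if $(\hat a,\hat b)$ is equivalent to $(\hat a^{(j)},\hat b^{(j)})$ for some $j\in I$. Then $Y$ is ACM if and only if one of the following holds: 1. $X$ is not weak determinantal, and $Y$ is a complete intersection.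 2. $X$ is weak determinantal, and one of the following holds: * (i) $Y$ is a complete intersection. * (ii) $Y$ is not a complete intersection, $F$ is a minimal generator of $I_Y$, and there are $j\in I$ and $k\in\mathbb{Z}$ such that, writing $(\hat a^{(j)},\hat b^{(j)})=((a_1,\dots,a_t),(b_1,\dots,b_t))$, $Y$ has the minimal free resolution $$0\to\bigoplus_{i=1}^{t}\mathcal{O}_{\mathbb{P}^n}(-(b_i+k))\to\bigoplus_{i=1}^{t}\mathcal{O}_{\mathbb{P}^n}(-(a_i+k))\oplus\mathcal{O}_{\mathbb{P}^n}(-d)\to\mathscr{I}_Y\to0.$$ * (iii) $Y$ is not a complete intersection, $F$ is not a minimal generator of $I_Y$, and there are $j\in I$ and $j_0\in\{1,\dots,t\}$ such that, writing $(\hat a^{(j)},\hat b^{(j)})=((a_1,\dots,a_t),(b_1,\dots,b_t))$, $Y$ has the minimal free resolution $$0\to\bigoplus_{i\ne j_0}\mathcal{O}_{\mathbb{P}^n}(-d+b_{j_0}-b_i)\to\bigoplus_{i=1}^{t}\mathcal{O}_{\mathbb{P}^n}(-d+b_{j_0}-a_i)\to\mathscr{I}_Y\to0.$$ -/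

import Mathlib

open MvPolynomial

namespace ACMHypersurface

attribute [local instance] MvPolynomial.gradedAlgebra

/-- The homogeneous coordinate ring `ℂ[x₀, …, xₙ]` of projective `n`-space over `ℂ`. -/
abbrev CoordRing (n : ℕ) : Type := MvPolynomial (Fin (n + 1)) ℂ

/-- A polynomial `p` is homogeneous of degree `e`, where `e` is an integer.  The zero polynomial
is homogeneous of every degree, and it is the only one that is homogeneous of a negative degree. -/
def IsHomogeneousOfDegree {n : ℕ} (p : CoordRing n) (e : ℤ) : Prop :=
  ∀ m : Fin (n + 1) →₀ ℕ, coeff m p ≠ 0 → ((m.degree : ℕ) : ℤ) = e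

/-- The irrelevant ideal `(x₀, …, xₙ)`. -/
noncomputable def irrelevantIdeal (n : ℕ) : Ideal (CoordRing n) :=
  Ideal.span (Set.range fun i : Fin (n + 1) => (X i : CoordRing n))

/-- A closed subscheme `Y` of `ℙⁿ` over `ℂ`, given by its homogeneous ideal, that is, by the
saturated homogeneous ideal `I_Y = ⨁ₘ H⁰(ℙⁿ, 𝓘_Y(m))` of `ℂ[x₀, …, xₙ]`. -/
structure ClosedSubscheme (n : ℕ) where
  /-- the homogeneous ideal of `Y` -/
  ideal : HomogeneousIdeal (homogeneousSubmodule (Fin (n + 1)) ℂ)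
  saturated : ∀ f : CoordRing n, (∀ i : Fin (n + 1), X i * f ∈ ideal) → f ∈ ideal

/-- A commutative ring (assumed Noetherian where this is used) is Cohen–Macaulay if for every
maximal ideal `𝔪` the depth of the local ring `R_𝔪` equals its Krull dimension.  As the length
of a regular sequence never exceeds the dimension, this says that `R_𝔪` has a regular sequence
(necessarily contained in its maximal ideal) of length `dim R_𝔪`. -/
def IsCohenMacaulayRing (R : Type*) [CommRing R] : Prop :=
  ∀ (p : Ideal R) [p.IsMaximal], ∃ rs : List (Localization.AtPrime p),
    RingTheory.Sequence.IsRegular (Localization.AtPrime p) rs ∧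
      ((rs.length : ℕ) : WithBot ℕ∞) = ringKrullDim (Localization.AtPrime p)

namespace ClosedSubscheme

variable {n : ℕ}

/-- `Y` is contained (as a closed subscheme) in the hypersurface `V(F)`. -/
def IsContainedIn (Y : ClosedSubscheme n) (F : CoordRing n) : Prop :=
  F ∈ Y.ideal

/-- `Y ⊆ V(F)` has codimension one in the hypersurface `V(F)`: the ideal of `Y` in the homogeneous
coordinate ring `ℂ[x₀, …, xₙ] / (F)` of the hypersurface has height one. -/
def HasCodimOneIn (Y : ClosedSubscheme n) (F : CoordRing n) : Prop :=
  (Y.ideal.toIdeal.map (Ideal.Quotient.mk (Ideal.span {F}))).height = 1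

/-- `Y` is arithmetically Cohen–Macaulay: its homogeneous coordinate ring is Cohen–Macaulay. -/
def IsACM (Y : ClosedSubscheme n) : Prop :=
  IsCohenMacaulayRing (CoordRing n ⧸ Y.ideal.toIdeal)

/-- `Y` is a complete intersection: its homogeneous ideal is generated by as many homogeneous
elements as the codimension of `Y` in `ℙⁿ`. -/
def IsCompleteIntersection (Y : ClosedSubscheme n) : Prop :=
  ∃ r : ℕ, Y.ideal.toIdeal.height = (r : ℕ∞) ∧
    ∃ f : Fin r → CoordRing n, (∀ i, ∃ m : ℕ, (f i).IsHomogeneous m) ∧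
      Ideal.span (Set.range f) = Y.ideal.toIdeal

/-- `F` is a minimal generator of the homogeneous ideal of `Y`: it belongs to a set of homogeneous
generators of this ideal from which no element can be left out. -/
def HasMinimalGenerator (Y : ClosedSubscheme n) (F : CoordRing n) : Prop :=
  ∃ G : Set (CoordRing n), (∀ g ∈ G, ∃ m : ℕ, g.IsHomogeneous m) ∧
    Ideal.span G = Y.ideal.toIdeal ∧
    (∀ g ∈ G, Ideal.span (G \ {g}) ≠ Y.ideal.toIdeal) ∧ F ∈ G

/-- The homogeneous ideal of `Y` has a minimal graded free resolution
`0 → ⨁ⱼ S(-βⱼ) → ⨁ᵢ S(-αᵢ) → I_Y → 0` over `S = ℂ[x₀, …, xₙ]`.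

The map `⨁ᵢ S(-αᵢ) → I_Y` sends the `i`-th basis vector to `g i`, homogeneous of degree `αᵢ`, and
the map `⨁ⱼ S(-βⱼ) → ⨁ᵢ S(-αᵢ)` is given by a matrix `M` whose entry at `(i, j)` is homogeneous of
degree `βⱼ - αᵢ`.  The complex is exact, and it is minimal: every entry of `M` lies in the
irrelevant ideal. -/
def HasMinimalFreeResolution (Y : ClosedSubscheme n) {ι κ : Type} [Fintype ι] [Fintype κ]
    (α : ι → ℤ) (β : κ → ℤ) : Prop :=
  ∃ (g : ι → CoordRing n) (M : Matrix ι κ (CoordRing n)),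
    (∀ i, IsHomogeneousOfDegree (g i) (α i)) ∧
    (∀ i j, IsHomogeneousOfDegree (M i j) (β j - α i)) ∧
    (∀ i j, M i j ∈ irrelevantIdeal n) ∧
    Function.Injective M.mulVecLin ∧
    Function.Exact M.mulVecLin (Fintype.linearCombination (CoordRing n) g) ∧
    LinearMap.range (Fintype.linearCombination (CoordRing n) g) = Y.ideal.toIdeal

end ClosedSubscheme

/-- A weak admissible pair `(â, b̂)` of length `t ≥ 2`. -/
structure WeakAdmissiblePair where
  /-- the length of the pair -/
  t : ℕ
  two_le : 2 ≤ t
  /-- the first sequence -/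
  a : Fin t → ℤ
  /-- the second sequence -/
  b : Fin t → ℤ
  a_mono : Monotone a
  b_mono : Monotone b
  a_lt_b : ∀ i, a i < b i

/-- Two weak admissible pairs are equivalent if they have the same length and differ by a
simultaneous shift of all their entries. -/
def WeakAdmissiblePair.Equivalent (P Q : WeakAdmissiblePair) : Prop :=
  ∃ (h : P.t = Q.t) (k : ℤ), ∀ i : Fin P.t,
    Q.a (Fin.cast h i) = P.a i + k ∧ Q.b (Fin.cast h i) = P.b i + k

/-- The hypersurface `V(F)` is weak determinantal of type `P = (â, b̂)`: `F = det S` for a square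
matrix `S` whose entry at `(i, j)` is homogeneous of degree `bⱼ - aᵢ`, and is zero if `aᵢ ≥ bⱼ`. -/
def IsWeakDeterminantalOfType {n : ℕ} (F : CoordRing n) (P : WeakAdmissiblePair) : Prop :=
  ∃ S : Matrix (Fin P.t) (Fin P.t) (CoordRing n),
    (∀ i j, IsHomogeneousOfDegree (S i j) (P.b j - P.a i)) ∧
    (∀ i j, P.b j ≤ P.a i → S i j = 0) ∧
    F = S.det

/-- The hypersurface `V(F)` is weak determinantal (of some type). -/
def IsWeakDeterminantal {n : ℕ} (F : CoordRing n) : Prop :=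
  ∃ P : WeakAdmissiblePair, IsWeakDeterminantalOfType F P

/-- The types of `V(F)` are the members of the family `T`, and only these, where equivalent weak
admissible pairs count as the same type.  (The family is empty if and only if `V(F)` is not weak
determinantal.) -/
def HasExactlyTypes {n : ℕ} (F : CoordRing n) {I : Type*} (T : I → WeakAdmissiblePair) : Prop :=
  ∀ P : WeakAdmissiblePair, IsWeakDeterminantalOfType F P ↔ ∃ j : I, (T j).Equivalent P

end ACMHypersurface

/-! Write `S` for the coordinate ring, `𝔪` for its irrelevant ideal and `I` for the ideal of `Y`.
Since `Y` has codimension one in `X`, `I` has height two. For such an ideal, `S/I` is Cohen–Macaulay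
exactly when `I` has a free resolution of length one. This is the Auslander–Buchsbaum formula,
obtained here by counting depth along short exact sequences.

If a resolution is given (the Koszul complex for a complete intersection), then `S/I` has depth at
least `n - 1` at every maximal ideal, and its dimension there is at most `n - 1`
(`isCohenMacaulayRing_of_resolution`).

Conversely, let `Y` be ACM and not a complete intersection, with minimal generators `g`. Over the
localization at `𝔪` the syzygies of `g` have depth `n + 1`, so they are free. Hence minimal
generators of the syzygies are already independent over `S` (`linearIndependent_syzygies`), and they
form an `(r+1) × r` matrix `M`. By Hilbert–Burch (`exists_isUnit_lastColumnDet_eq`), `det (M | v) =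
u * ∑ vᵢ gᵢ` for every column `v`, with one unit `u`.

Now write `F = ∑ cᵢ gᵢ` with homogeneous `cᵢ`. If all `cᵢ` lie in `𝔪`, then `F` is not a minimal
generator and `F` is, up to a unit, the determinant of `(M | c)`, of size `t = r + 1`. The added
column has degree `d`, which fixes the shift as `d - b_{j₀}`. If some `cᵢ` is a nonzero constant,
then `F` can replace `gᵢ`, and taking for `v` the corresponding basis vector shows that `F` is, up
to a unit, the minor of `M` without the row of `F`, of size `t = r`. Sorting the degrees gives a
weak admissible pair (`exists_isWeakDeterminantalOfType`). -/

namespace ACMHypersurface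
-- Depth, expressed through vanishing of Ext.
section Depth
open CategoryTheory Abelian RingTheory.Sequence Pointwise

variable {R : Type} [CommRing R]

/-- `Extⁱ(R/P, M)` vanishes for all `i < d`. -/
def ExtVanishesBelow (P : Ideal R) (M : Type) [AddCommGroup M] [Module R M] (d : ℕ) : Prop :=
  ∀ i < d, Subsingleton (Ext (ModuleCat.of R (R ⧸ P)) (ModuleCat.of R M) i)

section Sequences

variable {P : Ideal R} {M₁ M₂ M₃ : Type} [AddCommGroup M₁] [Module R M₁] [AddCommGroup M₂]
  [Module R M₂] [AddCommGroup M₃] [Module R M₃] {f : M₁ →ₗ[R] M₂} {g : M₂ →ₗ[R] M₃} {d : ℕ}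

lemma shortExact_of_linearMap (hf : Function.Injective f) (hfg : Function.Exact f g)
    (hg : Function.Surjective g) :
    (ModuleCat.shortComplexOfCompEqZero f g hfg.linearMap_comp_eq_zero).ShortExact where
  exact := ModuleCat.shortComplex_exact _ hfg
  mono_f := (ModuleCat.mono_iff_injective _).mpr hf
  epi_g := (ModuleCat.epi_iff_surjective _).mpr hg

lemma ExtVanishesBelow.mono {e : ℕ} (h : ExtVanishesBelow P M₁ d) (hed : e ≤ d) :
    ExtVanishesBelow P M₁ e :=
  fun i hi => h i (hi.trans_le hed)

/-- First of the three depth inequalities for a short exact sequence, all read off the long exact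
Ext sequence. Here `Extⁱ` of the cokernel sits between `Extⁱ` of `M₂` and `Extⁱ⁺¹` of `M₁`. -/
lemma ExtVanishesBelow.right (h₂ : ExtVanishesBelow P M₂ d) (h₁ : ExtVanishesBelow P M₁ (d + 1))
    (hf : Function.Injective f) (hfg : Function.Exact f g) (hg : Function.Surjective g) :
    ExtVanishesBelow P M₃ d := by
  intro i hi
  have zero1 := AddCommGrpCat.isZero_of_iff_subsingleton.mpr (h₂ i hi)
  have zero2 := AddCommGrpCat.isZero_of_iff_subsingleton.mpr (h₁ (i + 1) (by omega))
  exact AddCommGrpCat.subsingleton_of_isZero <| ShortComplex.Exact.isZero_of_both_zeros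
    (Ext.covariant_sequence_exact₃' _ (shortExact_of_linearMap hf hfg hg) i (i + 1) rfl)
    (zero1.eq_zero_of_src _) (zero2.eq_zero_of_tgt _)

lemma ExtVanishesBelow.left (h₂ : ExtVanishesBelow P M₂ (d + 1)) (h₃ : ExtVanishesBelow P M₃ d)
    (hf : Function.Injective f) (hfg : Function.Exact f g) (hg : Function.Surjective g) :
    ExtVanishesBelow P M₁ (d + 1) := by
  intro i hi
  rcases i with _ | i
  -- In degree zero no connecting map precedes, and left exactness of Hom takes its place.
  · have h := h₂ 0 hi
    have : Subsingleton ((R ⧸ P) →ₗ[R] M₂) :=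
      (Ext.addEquiv₀ (X := ModuleCat.of R (R ⧸ P)) (Y := ModuleCat.of R M₂)).trans
        ModuleCat.homAddEquiv |>.symm.subsingleton
    refine @Equiv.subsingleton _ _ (Ext.addEquiv₀.trans ModuleCat.homAddEquiv).toEquiv ?_
    refine ⟨fun a b => LinearMap.ext fun x => hf ?_⟩
    exact LinearMap.congr_fun (Subsingleton.elim (f ∘ₗ a) (f ∘ₗ b)) x
  · have zero1 := AddCommGrpCat.isZero_of_iff_subsingleton.mpr (h₂ (i + 1) hi)
    have zero2 := AddCommGrpCat.isZero_of_iff_subsingleton.mpr (h₃ i (by omega))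
    exact AddCommGrpCat.subsingleton_of_isZero <| ShortComplex.Exact.isZero_of_both_zeros
      (Ext.covariant_sequence_exact₁' _ (shortExact_of_linearMap hf hfg hg) i (i + 1) rfl)
      (zero2.eq_zero_of_src _) (zero1.eq_zero_of_tgt _)

lemma ExtVanishesBelow.middle (h₁ : ExtVanishesBelow P M₁ d) (h₃ : ExtVanishesBelow P M₃ d)
    (hf : Function.Injective f) (hfg : Function.Exact f g) (hg : Function.Surjective g) :
    ExtVanishesBelow P M₂ d := by
  intro i hi
  have zero1 := AddCommGrpCat.isZero_of_iff_subsingleton.mpr (h₁ i hi)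
  have zero2 := AddCommGrpCat.isZero_of_iff_subsingleton.mpr (h₃ i hi)
  exact AddCommGrpCat.subsingleton_of_isZero <| ShortComplex.Exact.isZero_of_both_zeros
    (Ext.covariant_sequence_exact₂' _ (shortExact_of_linearMap hf hfg hg) i)
    (zero1.eq_zero_of_src _) (zero2.eq_zero_of_tgt _)

lemma ExtVanishesBelow.of_subsingleton [Subsingleton M₁] : ExtVanishesBelow P M₁ d := by
  intro i _
  have h0 : 𝟙 (ModuleCat.of R M₁) = 0 := by
    ext x
    exact Subsingleton.elim (α := M₁) _ _
  refine ⟨fun a b => ?_⟩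
  have key : ∀ a : Ext (ModuleCat.of R (R ⧸ P)) (ModuleCat.of R M₁) i, a = 0 := fun a => by
    rw [← Ext.comp_mk₀_id a, h0, Ext.mk₀_zero, Ext.comp_zero]
  rw [key a, key b]

lemma ExtVanishesBelow.congr (e : M₁ ≃ₗ[R] M₂) (h : ExtVanishesBelow P M₁ d) :
    ExtVanishesBelow P M₂ d :=
  h.middle (.of_subsingleton (M₁ := PUnit)) (f := e.toLinearMap) (g := 0) e.injective
    (by intro x; simp) (fun _ => ⟨0, rfl⟩)

lemma ExtVanishesBelow.pi_fin (h : ExtVanishesBelow P M₁ d) (k : ℕ) :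
    ExtVanishesBelow P (Fin k → M₁) d := by
  induction k with
  | zero => exact .of_subsingleton
  | succ k ih =>
    have e : (M₁ × (Fin k → M₁)) ≃ₗ[R] (Fin (k + 1) → M₁) := Fin.consLinearEquiv R fun _ => M₁
    refine .congr e (h.middle ih (f := LinearMap.inl R _ _) (g := LinearMap.snd R _ _)
      LinearMap.inl_injective ?_ LinearMap.snd_surjective)
    exact Function.Exact.inl_snd

lemma ExtVanishesBelow.pi (h : ExtVanishesBelow P M₁ d) (ι : Type) [Fintype ι] :
    ExtVanishesBelow P (ι → M₁) d :=
  .congr (LinearEquiv.funCongrLeft R M₁ (Fintype.equivFin ι)) (h.pi_fin _)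

end Sequences

lemma support_quotient_eq (P : Ideal R) :
    Module.support R (R ⧸ P) = PrimeSpectrum.zeroLocus P := by
  rw [Module.support_eq_zeroLocus, Ideal.annihilator_quotient]

variable {P : Ideal R} {M : Type} [AddCommGroup M] [Module R M] {d : ℕ}

lemma ExtVanishesBelow.quotSMulTop (h : ExtVanishesBelow P M (d + 1)) {x : R}
    (reg : IsSMulRegular M x) : ExtVanishesBelow P (QuotSMulTop x M) d :=
  (h.mono d.le_succ).right h (f := LinearMap.lsmul R M x) (g := (x • (⊤ : Submodule R M)).mkQ) reg
    (LinearMap.exact_lsmul_mkQ_smul_top M x) (Submodule.mkQ_surjective _)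

/-- A quotient `M₀ / im(R^κ → R^ι → M₀)` of depth at least `d`, resolved by free modules. -/
lemma ExtVanishesBelow.quotient_of_resolution {ι κ : Type} [Fintype ι] [Fintype κ]
    (h : ExtVanishesBelow P R (d + 2)) {φ : (κ → R) →ₗ[R] (ι → R)} {ψ : (ι → R) →ₗ[R] R}
    (hφ : Function.Injective φ) (hφψ : Function.Exact φ ψ) :
    ExtVanishesBelow P (R ⧸ LinearMap.range ψ) d := by
  -- One unit of depth is lost in passing from the free modules to the ideal, and a second one from
  -- the ideal to the quotient ring.
  have hI : ExtVanishesBelow P (LinearMap.range ψ) (d + 1) := by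
    refine ((h.pi ι).mono (by omega)).right (h.pi κ) (g := ψ.rangeRestrict) hφ ?_
      ψ.surjective_rangeRestrict
    intro x
    rw [← hφψ x, Subtype.ext_iff]
    rfl
  exact (h.mono (by omega)).right hI (f := (LinearMap.range ψ).subtype)
    (g := (LinearMap.range ψ).mkQ) Subtype.val_injective
    (LinearMap.exact_subtype_mkQ _) (Submodule.mkQ_surjective _)

variable [IsNoetherianRing R] [Module.Finite R M]

/-- Together with `ExtVanishesBelow.exists_isRegular` this is Rees' characterization of depth by
regular sequences contained in `P`. -/
lemma extVanishesBelow_of_isRegular (hP : P • (⊤ : Submodule R M) < ⊤) (rs : List R)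
    (mem : ∀ r ∈ rs, r ∈ P) (reg : IsRegular M rs) : ExtVanishesBelow P M rs.length :=
  ModuleCat.subsingleton_ext_of_exists_isRegular P (ModuleCat.of R (R ⧸ P))
    (support_quotient_eq P).subset (ModuleCat.of R M) hP rs mem reg

lemma ExtVanishesBelow.exists_isRegular (h : ExtVanishesBelow P M d)
    (hP : P • (⊤ : Submodule R M) < ⊤) :
    ∃ rs : List R, rs.length = d ∧ (∀ r ∈ rs, r ∈ P) ∧ IsRegular M rs :=
  ModuleCat.exists_isRegular_of_exists_subsingleton_ext P d (ModuleCat.of R M) hP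
    (ModuleCat.of R (R ⧸ P)) (support_quotient_eq P) h

end Depth
end ACMHypersurface

namespace ACMHypersurface
-- From a resolution of length one to the Cohen–Macaulay property.
section CohenMacaulay
open RingTheory.Sequence Pointwise

/-- Induction on `k`: a prime of height at least `k + 1` in `R ⧸ I` lies strictly above a prime of
height at least `k`, whose preimage lies strictly below `P`. -/
lemma height_add_le_height_of_le_height_map {R : Type*} [CommRing R] {I : Ideal R} (k : ℕ) :
    ∀ (P : Ideal R) [P.IsPrime], I ≤ P → (k : ℕ∞) ≤ (P.map (Ideal.Quotient.mk I)).height →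
      I.height + k ≤ P.height := by
  induction k with
  | zero => intro P _ hIP _; simpa using Ideal.height_mono hIP
  | succ k ih =>
    intro P _ hIP hk
    have hprime : (P.map (Ideal.Quotient.mk I)).IsPrime :=
      Ideal.map_isPrime_of_surjective Ideal.Quotient.mk_surjective (by simpa using hIP)
    have hnot : ¬ (P.map (Ideal.Quotient.mk I)).height ≤ (k : ℕ) := by
      intro h
      have := hk.trans h
      norm_cast at this
      omega
    rw [Ideal.height_le_iff] at hnot
    push Not at hnot
    obtain ⟨q, hq, hqP, hkq⟩ := hnot
    have hIq : I ≤ q.comap (Ideal.Quotient.mk I) := fun x hx => by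
      simp [Ideal.Quotient.eq_zero_iff_mem.mpr hx]
    have hmap : (q.comap (Ideal.Quotient.mk I)).map (Ideal.Quotient.mk I) = q :=
      Ideal.map_comap_of_surjective _ Ideal.Quotient.mk_surjective q
    have h1 := ih (q.comap (Ideal.Quotient.mk I)) hIq (by rwa [hmap])
    have hlt : q.comap (Ideal.Quotient.mk I) < P := by
      have hcomap : (P.map (Ideal.Quotient.mk I)).comap (Ideal.Quotient.mk I) = P := by
        rw [Ideal.comap_map_of_surjective _ Ideal.Quotient.mk_surjective]
        simpa [← RingHom.ker_eq_comap_bot] using hIP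
      rw [← hcomap]
      refine lt_of_le_of_ne (Ideal.comap_mono hqP.le) fun h => hqP.ne ?_
      rw [← hmap, h, hcomap]
    calc I.height + ((k + 1 : ℕ) : ℕ∞) = I.height + k + 1 := by push_cast; ring
      _ ≤ _ := (add_le_add_left h1 1).trans (Ideal.height_add_one_le_of_lt_of_isPrime hlt)

/-- Specialization of the variables with index less than `k` to the coordinates of `c`. -/
noncomputable def partialEval {n : ℕ} (c : Fin (n + 1) → ℂ) (k : ℕ) :
    CoordRing n →ₐ[ℂ] CoordRing n :=
  aeval fun j => if (j : ℕ) < k then C (c j) else X j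

/-- The list `x₀ - c₀, …, xₙ - cₙ`. -/
noncomputable def translatedVariables {n : ℕ} (c : Fin (n + 1) → ℂ) : List (CoordRing n) :=
  List.ofFn fun i => X i - C (c i)

/-- Modulo the first `k` of the forms `xⱼ - cⱼ`, specialization is the identity, so these forms
generate its kernel. The successive quotients thus embed in a domain, which makes the sequence
regular. -/
lemma mem_ofList_take_translatedVariables_iff {n : ℕ} (c : Fin (n + 1) → ℂ) (k : ℕ)
    (f : CoordRing n) :
    f ∈ Ideal.ofList ((translatedVariables c).take k) ↔ partialEval c k f = 0 := by
  have hmem : ∀ g : CoordRing n, g ∈ (translatedVariables c).take k ↔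
      ∃ j : Fin (n + 1), (j : ℕ) < k ∧ g = X j - C (c j) := by
    intro g
    simp only [List.mem_take_iff_getElem, translatedVariables, List.length_ofFn,
      List.getElem_ofFn]
    constructor
    · rintro ⟨i, hi, rfl⟩
      exact ⟨⟨i, by omega⟩, by simp; omega, rfl⟩
    · rintro ⟨j, hj, rfl⟩
      exact ⟨j, by omega, rfl⟩
  constructor
  · intro hf
    have : Ideal.ofList ((translatedVariables c).take k) ≤ RingHom.ker (partialEval c k) := by
      refine Ideal.span_le.mpr fun g hg => ?_
      obtain ⟨j, hj, rfl⟩ := (hmem g).mp hg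
      simp [partialEval, hj, algebraMap_eq]
    exact this hf
  · intro hf
    have key : (Ideal.Quotient.mkₐ ℂ (Ideal.ofList ((translatedVariables c).take k))).comp
        (partialEval c k) = Ideal.Quotient.mkₐ ℂ _ := by
      refine MvPolynomial.algHom_ext fun j => ?_
      by_cases hj : (j : ℕ) < k
      · simp only [partialEval, AlgHom.comp_apply, aeval_X, hj, if_true]
        refine (Ideal.Quotient.eq.mpr ?_).symm
        exact Ideal.subset_span ((hmem _).mpr ⟨j, hj, rfl⟩)
      · simp [partialEval, hj]
    have := DFunLike.congr_fun key f
    rw [AlgHom.comp_apply, hf, map_zero] at this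
    exact Ideal.Quotient.eq_zero_iff_mem.mp this.symm

lemma isWeaklyRegular_translatedVariables {n : ℕ} (c : Fin (n + 1) → ℂ) :
    IsWeaklyRegular (CoordRing n) (translatedVariables c) := by
  rw [isWeaklyRegular_iff_Fin]
  rintro ⟨i, hi⟩
  rw [isSMulRegular_quotient_iff_mem_of_smul_mem]
  intro x hx
  have hin : i < n + 1 := by simpa [translatedVariables] using hi
  simp only [smul_eq_mul, Ideal.mul_top, mem_ofList_take_translatedVariables_iff] at hx ⊢
  rw [map_mul] at hx
  refine (mul_eq_zero.mp hx).resolve_left ?_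
  have : partialEval c i (translatedVariables c)[i] = X ⟨i, hin⟩ - C (c ⟨i, hin⟩) := by
    simp only [translatedVariables, List.getElem_ofFn]
    simp [partialEval]
  simp only [Fin.getElem_fin, this]
  intro h
  have := congrArg (coeff (Finsupp.single (⟨i, hin⟩ : Fin (n + 1)) 1)) h
  have hne : (0 : Fin (n + 1) →₀ ℕ) ≠ Finsupp.single ⟨i, hin⟩ 1 := by
    simp [eq_comm]
  simp [coeff_C, hne] at this

/-- The Nullstellensatz over `ℂ`: it places a translated coordinate sequence inside every maximal
ideal. -/
lemma exists_mem_maximal_iff {n : ℕ} (P : Ideal (CoordRing n)) [hP : P.IsMaximal] :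
    ∃ c : Fin (n + 1) → ℂ, ∀ f, f ∈ P ↔ aeval c f = 0 := by
  obtain ⟨c, rfl⟩ := isMaximal_iff_eq_vanishingIdeal_singleton.mp hP
  exact ⟨c, fun f => mem_vanishingIdeal_singleton_iff c f⟩

lemma extVanishesBelow_coordRing {n : ℕ} (P : Ideal (CoordRing n)) [hP : P.IsMaximal] :
    ExtVanishesBelow P (CoordRing n) (n + 1) := by
  obtain ⟨c, hc⟩ := exists_mem_maximal_iff P
  have hmem : ∀ r ∈ translatedVariables c, r ∈ P := by
    intro r hr
    obtain ⟨i, rfl⟩ := (List.mem_ofFn' _ _).mp hr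
    simp [hc]
  have hlt : P • (⊤ : Submodule (CoordRing n) (CoordRing n)) < ⊤ := by
    simpa using hP.ne_top.lt_top
  have := extVanishesBelow_of_isRegular hlt (translatedVariables c) hmem
    ⟨isWeaklyRegular_translatedVariables c, fun h => hlt.ne (top_le_iff.mp (h.trans_le
      (Submodule.smul_mono_left (Ideal.span_le.mpr hmem))))⟩
  simpa [translatedVariables] using this

lemma ringKrullDim_coordRing (n : ℕ) : ringKrullDim (CoordRing n) = (n + 1 : ℕ) := by
  rw [MvPolynomial.ringKrullDim_of_isNoetherianRing]
  simp

/-- If an ideal of height two of the coordinate ring has a free resolution of length one, then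
the quotient has a regular sequence of length `n - 1` at each maximal ideal. -/
lemma exists_isRegular_of_resolution {n : ℕ} {ι κ : Type} [Fintype ι] [Fintype κ]
    (hn : 1 ≤ n)
    {φ : (κ → CoordRing n) →ₗ[CoordRing n] (ι → CoordRing n)}
    {ψ : (ι → CoordRing n) →ₗ[CoordRing n] CoordRing n}
    (hφ : Function.Injective φ) (hφψ : Function.Exact φ ψ) (I : Ideal (CoordRing n))
    (hI : LinearMap.range ψ = I) (P : Ideal (CoordRing n)) [P.IsMaximal] (hIP : I ≤ P) :
    ∃ rs : List (CoordRing n), rs.length = n - 1 ∧ (∀ r ∈ rs, r ∈ P) ∧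
      IsRegular (CoordRing n ⧸ I) rs := by
  subst hI
  have h := extVanishesBelow_coordRing P
  -- As `1 ≤ n`, the truncated `n - 1 + 2` is the full depth `n + 1`; the resolution costs two.
  replace h : ExtVanishesBelow P (CoordRing n) (n - 1 + 2) := h.mono (by omega)
  refine (h.quotient_of_resolution hφ hφψ).exists_isRegular ?_
  -- Otherwise `1` would lie in `P + I`, which is `P`.
  refine lt_top_iff_ne_top.mpr fun htop => ?_
  have h1 : (Submodule.Quotient.mk 1 : CoordRing n ⧸ LinearMap.range ψ) ∈
      P • (⊤ : Submodule (CoordRing n) (CoordRing n ⧸ LinearMap.range ψ)) := by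
        rw [htop]; exact Submodule.mem_top
  rw [← Submodule.mkQ_apply, ← Submodule.mem_comap,
    Submodule.comap_smul_top_of_surjective P _ (Submodule.mkQ_surjective _)] at h1
  have h2 : (1 : CoordRing n) ∈ P := by
    refine (sup_le ?_ ?_ : _ ≤ P) h1
    · simp
    · simpa using hIP
  exact Ideal.IsPrime.ne_top' ((Ideal.eq_top_iff_one P).mpr h2)

lemma length_le_ringKrullDim_of_isRegular {R : Type*} [CommRing R] [IsLocalRing R]
    [IsNoetherianRing R] {rs : List R} (h : IsRegular R rs) :
    ((rs.length : ℕ) : WithBot ℕ∞) ≤ ringKrullDim R := by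
  rw [← ringKrullDim_add_length_eq_ringKrullDim_of_isRegular _ h]
  have : Nontrivial (R ⧸ Ideal.ofList rs) :=
    Ideal.Quotient.nontrivial_iff.mpr fun htop => h.2 (by rw [htop]; simp)
  simpa using add_le_add_left (ringKrullDim_nonneg_of_nontrivial (R := R ⧸ Ideal.ofList rs)) _

/-- The resolution gives depth at least `n - 1`. A local dimension of `n` or more would, with `2 ≤
I.height`, give a prime of height `n + 2` in a ring of dimension `n + 1`. Since depth never exceeds
dimension, the two agree. -/
lemma isCohenMacaulayRing_of_resolution {n : ℕ} {ι κ : Type} [Fintype ι] [Fintype κ]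
    {φ : (κ → CoordRing n) →ₗ[CoordRing n] (ι → CoordRing n)}
    {ψ : (ι → CoordRing n) →ₗ[CoordRing n] CoordRing n}
    (hφ : Function.Injective φ) (hφψ : Function.Exact φ ψ) (I : Ideal (CoordRing n))
    (hI : LinearMap.range ψ = I) (hheight : 2 ≤ I.height) :
    IsCohenMacaulayRing (CoordRing n ⧸ I) := by
  intro p hp
  let P := p.comap (Ideal.Quotient.mk I)
  have hPmax : P.IsMaximal := Ideal.comap_isMaximal_of_surjective _ Ideal.Quotient.mk_surjective
  have hIP : I ≤ P := fun x hx => by simp [P, Ideal.Quotient.eq_zero_iff_mem.mpr hx]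
  have hmap : P.map (Ideal.Quotient.mk I) = p :=
    Ideal.map_comap_of_surjective _ Ideal.Quotient.mk_surjective p
  have hPle : P.height ≤ (n + 1 : ℕ) := by
    have := Ideal.height_le_ringKrullDim_of_isPrime (I := P)
    rw [ringKrullDim_coordRing] at this
    exact_mod_cast this
  have hn : 1 ≤ n := by
    have := (hheight.trans (Ideal.height_mono hIP)).trans hPle
    norm_cast at this
    omega
  obtain ⟨rs, hlen, hmem, hreg⟩ := exists_isRegular_of_resolution hn hφ hφψ I hI P hIP
  have hw : IsWeaklyRegular (CoordRing n ⧸ I) (rs.map (algebraMap (CoordRing n) (CoordRing n ⧸ I))) :=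
    (isWeaklyRegular_map_algebraMap_iff _ _ rs).mpr hreg.1
  have hreg' := hw.isRegular_of_isLocalization_of_mem (Localization.AtPrime p) p (by
    intro r hr
    obtain ⟨s, hs, rfl⟩ := List.mem_map.mp hr
    exact hmem s hs)
  refine ⟨_, hreg', le_antisymm ?_ ?_⟩
  · exact length_le_ringKrullDim_of_isRegular hreg'
  · rw [IsLocalization.AtPrime.ringKrullDim_eq_height p]
    norm_cast
    simp only [List.length_map, hlen]
    by_contra hlt
    push Not at hlt
    have hle : ((n : ℕ) : ℕ∞) ≤ p.height := by
      have := Order.add_one_le_of_lt hlt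
      norm_cast at this
      rwa [Nat.sub_add_cancel hn] at this
    have := (height_add_le_height_of_le_height_map n P hIP (hmap.symm ▸ hle)).trans hPle
    have := (add_le_add_left hheight (n : ℕ∞)).trans this
    norm_cast at this
    omega

end CohenMacaulay
end ACMHypersurface

namespace ACMHypersurface
-- A lower bound for the dimension of `S/I` at the irrelevant ideal.
section Dimension
open RingTheory.Sequence Pointwise

/-- The elements of a regular sequence on `M` in a prime `P` can be used to prolong chains of
primes that start at an associated prime of `M`. -/
lemma height_map_add_length_le {R : Type*} [CommRing R] [IsNoetherianRing R] {I P : Ideal R}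
    [P.IsPrime] (rs : List R) (hrs : ∀ r ∈ rs, r ∈ P) :
    ∀ (M : Type) [AddCommGroup M] [Module R M] [Module.Finite R M], IsWeaklyRegular M rs →
      ∀ p ∈ associatedPrimes R M, p ≤ P → I ≤ p →
        (p.map (Ideal.Quotient.mk I)).height + rs.length ≤ (P.map (Ideal.Quotient.mk I)).height := by
  induction rs with
  | nil => intro M _ _ _ _ p _ hpP _; simpa using Ideal.height_mono (Ideal.map_mono hpP)
  | cons x rs ih =>
    intro M _ _ _ hreg p hp hpP hIp
    rw [isWeaklyRegular_cons_iff] at hreg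
    obtain ⟨hprime, y, hy⟩ := isAssociatedPrime_iff.mp hp
    have hy' : ∀ r, r ∈ p ↔ r • y = 0 := fun r => by rw [hy, Submodule.mem_colon_singleton]; simp
    -- `N` consists of the elements killed by `p`. A prime `q ≤ P` minimal over the annihilator of
    -- `N/xN` contains both `p` and `x`, and `x ∉ p`, so the chain grows by one. Since `N/xN` embeds
    -- in `M/xM`, `q` is associated to `M/xM` and the induction continues.
    let N := Submodule.torsionBySet R M (p : Set R)
    have hyN : y ∈ N := (Submodule.mem_torsionBySet_iff _ _).mpr fun r => (hy' r).mp r.2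
    have hsupp : (⟨P, inferInstance⟩ : PrimeSpectrum R) ∈ Module.support R N := by
      rw [Module.mem_support_iff_of_finite]
      intro r hr
      refine hpP ((hy' r).mpr ?_)
      simpa using congrArg Subtype.val (Module.mem_annihilator.mp hr ⟨y, hyN⟩)
    have hsupp' : (⟨P, inferInstance⟩ : PrimeSpectrum R) ∈ Module.support R (QuotSMulTop x N) := by
      rw [Module.support_quotSMulTop]
      exact ⟨hsupp, by simpa [PrimeSpectrum.mem_zeroLocus] using hrs x (by simp)⟩
    rw [Module.mem_support_iff_of_finite] at hsupp'
    obtain ⟨q, hq, hqP⟩ := Ideal.exists_minimalPrimes_le hsupp'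
    have hqass := Module.associatedPrimes.minimalPrimes_annihilator_subset_associatedPrimes R _ hq
    have hinj : Function.Injective (QuotSMulTop.map x N.subtype) := by
      rw [← LinearMap.ker_eq_bot, LinearMap.ker_eq_bot']
      intro z hz
      obtain ⟨z, rfl⟩ := Submodule.Quotient.mk_surjective _ z
      rw [QuotSMulTop.map_apply_mk, Submodule.Quotient.mk_eq_zero,
        Submodule.mem_smul_pointwise_iff_exists] at hz
      obtain ⟨w, -, hw⟩ := hz
      -- `N` is saturated with respect to `x`: if `p` kills `x • w`, it kills `w`, because `x` is
      -- regular on `M`.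
      have hwN : w ∈ N := by
        refine (Submodule.mem_torsionBySet_iff _ _).mpr fun r => ?_
        refine hreg.1.right_eq_zero_of_smul ?_
        rw [smul_comm, hw]
        exact (Submodule.mem_torsionBySet_iff _ _).mp z.2 r
      rw [Submodule.Quotient.mk_eq_zero, Submodule.mem_smul_pointwise_iff_exists]
      exact ⟨⟨w, hwN⟩, trivial, Subtype.ext hw⟩
    have hqM := associatedPrimes.subset_of_injective hinj hqass
    have hqprime : q.IsPrime := hqM.isPrime
    have hpq : p ≤ q := by
      refine le_trans (fun r hr => ?_) hq.1.2
      rw [Module.mem_annihilator]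
      intro z
      obtain ⟨z, rfl⟩ := Submodule.Quotient.mk_surjective _ z
      rw [← Submodule.Quotient.mk_smul]
      have : r • z = 0 :=
        Subtype.ext ((Submodule.mem_torsionBySet_iff _ _).mp z.2 ⟨r, hr⟩)
      rw [this, Submodule.Quotient.mk_zero]
    have hxq : x ∈ q := by
      refine hq.1.2 ?_
      rw [Module.mem_annihilator]
      intro z
      obtain ⟨z, rfl⟩ := Submodule.Quotient.mk_surjective _ z
      rw [← Submodule.Quotient.mk_smul, Submodule.Quotient.mk_eq_zero]
      exact Submodule.smul_mem_pointwise_smul z x _ trivial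
    have hxp : x ∉ p := by
      intro hx
      have hy0 : y = 0 := hreg.1.right_eq_zero_of_smul ((hy' x).mp hx)
      exact hprime.ne_top ((Ideal.eq_top_iff_one p).mpr ((hy' 1).mpr (by simp [hy0])))
    have hIq := hIp.trans hpq
    have h1 : (p.map (Ideal.Quotient.mk I)).IsPrime :=
      Ideal.map_isPrime_of_surjective Ideal.Quotient.mk_surjective (by simpa using hIp)
    have h2 : (q.map (Ideal.Quotient.mk I)).IsPrime :=
      Ideal.map_isPrime_of_surjective Ideal.Quotient.mk_surjective (by simpa using hIq)
    have hlt : p.map (Ideal.Quotient.mk I) < q.map (Ideal.Quotient.mk I) := by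
      refine lt_of_le_of_ne (Ideal.map_mono hpq) fun h => hxp ?_
      have hx : Ideal.Quotient.mk I x ∈ p.map (Ideal.Quotient.mk I) :=
        h ▸ Ideal.mem_map_of_mem _ hxq
      rw [Ideal.mem_map_iff_of_surjective _ Ideal.Quotient.mk_surjective] at hx
      obtain ⟨w, hw, hwx⟩ := hx
      have := hIp (Ideal.Quotient.eq.mp hwx)
      simpa using sub_mem hw this
    calc (p.map (Ideal.Quotient.mk I)).height + ((x :: rs).length : ℕ∞)
        = (p.map (Ideal.Quotient.mk I)).height + 1 + rs.length := by
          push_cast [List.length_cons]; ring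
      _ ≤ (q.map (Ideal.Quotient.mk I)).height + rs.length :=
          add_le_add_left (Ideal.height_add_one_le_of_lt_of_isPrime hlt) _
      _ ≤ _ := ih (fun r hr => hrs r (by simp [hr])) _ hreg.2 q hqM hqP hIq

/-- Krull's principal ideal theorem, used below to exclude a common non-unit factor of generators.
-/
lemma not_le_span_singleton_of_two_le_height {R : Type*} [CommRing R] [IsNoetherianRing R]
    {I : Ideal R} (h : 2 ≤ I.height) {q : R} (hq : ¬ IsUnit q) : ¬ I ≤ Ideal.span {q} := by
  intro hle
  have := (h.trans (Ideal.height_mono hle)).trans (Ideal.height_span_singleton_le_one hq)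
  norm_num at this

/-- The Koszul relation of two elements. -/
noncomputable def koszulMap {R : Type*} [CommRing R] (f : Fin 2 → R) :
    (Fin 1 → R) →ₗ[R] (Fin 2 → R) :=
  LinearMap.pi ![f 1 • LinearMap.proj 0, -(f 0 • LinearMap.proj 0)]

/-- The Koszul complex of two elements generating a proper ideal of height two is exact. -/
lemma koszulMap_injective_and_exact {R : Type*} [CommRing R] [IsDomain R] [IsNoetherianRing R]
    [UniqueFactorizationMonoid R] (f : Fin 2 → R) (h : 2 ≤ (Ideal.span (Set.range f)).height) :
    Function.Injective (koszulMap f) ∧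
      Function.Exact (koszulMap f) (Fintype.linearCombination R f) := by
  have hrel : IsRelPrime (f 0) (f 1) := by
    intro d h0 h1
    by_contra hd
    refine not_le_span_singleton_of_two_le_height h hd (Ideal.span_le.mpr ?_)
    rintro _ ⟨i, rfl⟩
    fin_cases i
    · exact Ideal.mem_span_singleton.mpr h0
    · exact Ideal.mem_span_singleton.mpr h1
  have hφ : ∀ c : Fin 1 → R, koszulMap f c = ![f 1 * c 0, -(f 0 * c 0)] := by
    intro c
    ext i
    fin_cases i <;> simp [koszulMap]
  have hψ : ∀ v : Fin 2 → R, Fintype.linearCombination R f v = v 0 * f 0 + v 1 * f 1 := by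
    intro v; simp [Fintype.linearCombination_apply]
  have hne : f 0 ≠ 0 ∨ f 1 ≠ 0 := by
    by_contra! h0
    have : IsRelPrime (0 : R) 0 := by simpa [h0.1, h0.2] using hrel
    exact not_isUnit_zero (this (dvd_refl 0) (dvd_refl 0))
  constructor
  · rw [← LinearMap.ker_eq_bot, LinearMap.ker_eq_bot']
    intro c hc
    rw [hφ] at hc
    have h0 := congrFun hc 0
    have h1 := congrFun hc 1
    simp only [Matrix.cons_val_zero, Pi.zero_apply, mul_eq_zero, Matrix.cons_val_one, neg_eq_zero]
      at h0 h1
    ext i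
    fin_cases i
    rcases hne with hne | hne
    · simpa [hne] using h1
    · simpa [hne] using h0
  · intro v
    rw [hψ]
    constructor
    · intro hv
      have hdvd1 : f 1 ∣ v 0 := by
        refine hrel.symm.dvd_of_dvd_mul_right ⟨-v 1, ?_⟩
        linear_combination hv
      have hdvd0 : f 0 ∣ v 1 := by
        refine hrel.dvd_of_dvd_mul_right ⟨-v 0, ?_⟩
        linear_combination hv
      obtain ⟨a, ha⟩ := hdvd1
      obtain ⟨b, hb⟩ := hdvd0
      rw [ha, hb] at hv
      -- Only one of the two elements is known to be nonzero; if the other vanishes, the preimage is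
      -- read off the remaining coordinate.
      rcases hne with hne | hne
      · by_cases h1 : f 1 = 0
        · refine ⟨fun _ => -b, ?_⟩
          rw [hφ]
          ext i
          fin_cases i <;> simp [ha, hb, h1]
        · refine ⟨fun _ => a, ?_⟩
          have : a + b = 0 := by
            have : f 0 * f 1 * (a + b) = 0 := by linear_combination hv
            simpa [hne, h1] using this
          rw [hφ]
          ext i
          fin_cases i
          · simp [ha]
          · have : b = -a := by linear_combination this
            simp [hb, this]
      · refine ⟨fun _ => a, ?_⟩
        by_cases h0 : f 0 = 0
        · rw [hφ]
          ext i
          fin_cases i <;> simp [ha, hb, h0]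
        · have : a + b = 0 := by
            have : f 0 * f 1 * (a + b) = 0 := by linear_combination hv
            simpa [hne, h0] using this
          have : b = -a := by linear_combination this
          rw [hφ]
          ext i
          fin_cases i
          · simp [ha]
          · simp [hb, this]
    · rintro ⟨c, rfl⟩
      rw [hφ]
      simp
      ring

/-- A lower bound for the local dimension of a quotient of the coordinate ring. -/
lemma le_height_map_of_height_eq_two {n : ℕ} {I P Q : Ideal (CoordRing n)} [P.IsMaximal]
    [Q.IsPrime] (hIQ : I ≤ Q) (hQP : Q ≤ P) (hQ : Q.height = 2) :
    ((n - 1 : ℕ) : ℕ∞) ≤ (P.map (Ideal.Quotient.mk I)).height := by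
  have hn : 1 ≤ n := by
    have h := Ideal.height_le_ringKrullDim_of_isPrime (I := Q)
    rw [ringKrullDim_coordRing, hQ] at h
    have : (2 : ℕ) ≤ n + 1 := by exact_mod_cast h
    omega
  -- The converse of Krull's height theorem gives a two-generated `J ≤ Q` of height at least two. By
  -- its Koszul complex, `S/J` has a regular sequence of length `n - 1` in `P`. As `Q` is minimal
  -- over `J`, it is associated to `S/J`, and the sequence prolongs a chain of primes from `Q` to
  -- `P`.
  obtain ⟨J, hJQ, hJrank, hJ⟩ := exists_spanRank_le_and_le_height_of_le_height Q 2 hQ.ge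
  have hJ2 : (2 : ℕ∞) ≤ J.height := by exact_mod_cast hJ
  obtain ⟨f, hf⟩ : ∃ f : Fin 2 → CoordRing n, Ideal.span (Set.range f) = J := by
    obtain ⟨s, hs, hsJ⟩ :=
      (Submodule.FG.spanRank_le_iff_exists_span_set_card_le J (a := 2)).mp
        (by exact_mod_cast hJrank)
    -- If there are fewer than two generators, the family is filled up with zeros or by repetition.
    rcases s.eq_empty_or_nonempty with rfl | hne
    · exact ⟨fun _ => 0, by rw [← hsJ]; simp⟩
    · have : Nonempty s := hne.to_subtype
      rw [show (2 : Cardinal) = Cardinal.mk (Fin 2) by simp, Cardinal.le_def] at hs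
      obtain ⟨e⟩ := hs
      refine ⟨fun i => (Function.invFun e i : s), ?_⟩
      rw [← hsJ]
      congr 1
      rw [Set.range_comp' Subtype.val (Function.invFun e),
        (Function.invFun_surjective e.injective).range_eq, Set.image_univ, Subtype.range_coe]
  obtain ⟨hinj, hex⟩ := koszulMap_injective_and_exact f (hf ▸ hJ2)
  obtain ⟨rs, hlen, hmem, hreg⟩ := exists_isRegular_of_resolution hn hinj hex J
    (by rw [Fintype.range_linearCombination]; exact hf) P (hJQ.trans hQP)
  have hass : Q ∈ associatedPrimes (CoordRing n) (CoordRing n ⧸ J) := by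
    refine Module.associatedPrimes.minimalPrimes_annihilator_subset_associatedPrimes _ _ ?_
    rw [Ideal.annihilator_quotient]
    exact Ideal.mem_minimalPrimes_of_height_le hJQ (hQ.trans_le hJ2)
  have := height_map_add_length_le (I := I) rs hmem _ hreg.1 Q hass hQP hIQ
  rw [hlen] at this
  exact le_add_self.trans this

end Dimension
end ACMHypersurface

namespace ACMHypersurface
-- Modules of maximal depth over a regular local ring are free.
section Free
open RingTheory.Sequence Pointwise IsLocalRing

/-- If `x = ∑ cᵢ yᵢ` is not in the square of the maximal ideal, then some `cᵢ` is a unit, so this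
`yᵢ` is redundant modulo `x`. -/
lemma span_range_quotient_of_notMem_sq {R : Type} [CommRing R] [IsLocalRing R] {N : ℕ}
    {y : Fin (N + 1) → R} (hy : Ideal.span (Set.range y) = maximalIdeal R) {x : R}
    (hx : x ∈ maximalIdeal R) (hx2 : x ∉ maximalIdeal R ^ 2) :
    ∃ z : Fin N → R ⧸ Ideal.span {x},
      Ideal.span (Set.range z) = (maximalIdeal R).map (Ideal.Quotient.mk (Ideal.span {x})) := by
  rw [← hy, Ideal.mem_span_range_iff_exists_fun] at hx
  obtain ⟨c, hc⟩ := hx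
  have hymem : ∀ i, y i ∈ maximalIdeal R := fun i => hy ▸ Ideal.subset_span ⟨i, rfl⟩
  obtain ⟨i, hi⟩ : ∃ i, IsUnit (c i) := by
    by_contra! h
    refine hx2 ?_
    rw [← hc, pow_two]
    exact Ideal.sum_mem _ fun i _ =>
      Ideal.mul_mem_mul ((mem_maximalIdeal _).mpr (h i)) (hymem i)
  refine ⟨fun j => Ideal.Quotient.mk _ (y (i.succAbove j)), ?_⟩
  rw [← hy, Ideal.map_span]
  apply le_antisymm
  · refine Ideal.span_mono ?_
    rintro _ ⟨j, rfl⟩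
    exact ⟨_, ⟨_, rfl⟩, rfl⟩
  · rw [Ideal.span_le]
    rintro _ ⟨_, ⟨k, rfl⟩, rfl⟩
    rcases Fin.eq_self_or_eq_succAbove i k with rfl | ⟨j, rfl⟩
    · obtain ⟨u, hu⟩ := hi.exists_left_inv
      have hsum : (0 : R ⧸ Ideal.span {x}) = ∑ j, Ideal.Quotient.mk _ (c j) *
          Ideal.Quotient.mk _ (y j) := by
        simp_rw [← map_mul, ← map_sum, hc]
        exact (Ideal.Quotient.eq_zero_iff_mem.mpr (Ideal.mem_span_singleton_self x)).symm
      rw [Fin.sum_univ_succAbove _ k] at hsum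
      have hu' : Ideal.Quotient.mk (Ideal.span {x}) u * Ideal.Quotient.mk _ (c k) = 1 := by
        rw [← map_mul, hu, map_one]
      have : Ideal.Quotient.mk (Ideal.span {x}) (y k) = - Ideal.Quotient.mk _ u *
          ∑ j, Ideal.Quotient.mk _ (c (k.succAbove j)) *
            Ideal.Quotient.mk _ (y (k.succAbove j)) := by
        linear_combination (- Ideal.Quotient.mk (Ideal.span {x}) u) * hsum -
          Ideal.Quotient.mk (Ideal.span {x}) (y k) * hu'
      rw [this]
      exact Ideal.mul_mem_left _ _ (Ideal.sum_mem _ fun j _ =>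
        Ideal.mul_mem_left _ _ (Ideal.subset_span ⟨j, rfl⟩))
    · exact Ideal.subset_span ⟨j, rfl⟩

/-- Prime avoidance for the associated primes of `M` together with the square of the maximal ideal.
The latter need not be prime, which avoidance permits for up to two of the ideals; both exceptional
places are given to it. -/
lemma exists_isSMulRegular_notMem_sq {R : Type} [CommRing R] [IsLocalRing R] [IsNoetherianRing R]
    {M : Type} [AddCommGroup M] [Module R M] [Module.Finite R M] [Nontrivial M] {r : R}
    (hr : r ∈ maximalIdeal R) (hreg : IsSMulRegular M r) (h2 : ¬ maximalIdeal R ≤ maximalIdeal R ^ 2) :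
    ∃ x ∈ maximalIdeal R, x ∉ maximalIdeal R ^ 2 ∧ IsSMulRegular M x := by
  classical
  have hfin : (associatedPrimes R M).Finite := associatedPrimes.finite R M
  by_contra! hcon
  let s : Finset (Ideal R) := insert (maximalIdeal R ^ 2) hfin.toFinset
  have hsub : (maximalIdeal R : Set R) ⊆ ⋃ i ∈ (s : Set (Ideal R)), (i : Set R) := by
    intro x hx
    by_cases hx2 : x ∈ maximalIdeal R ^ 2
    · exact Set.mem_biUnion (x := maximalIdeal R ^ 2) (by simp [s]) hx2
    · have hnot : x ∈ ({r : R | IsSMulRegular M r}ᶜ : Set R) := hcon x hx hx2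
      rw [← biUnion_associatedPrimes_eq_compl_regular] at hnot
      obtain ⟨p, hp, hxp⟩ := Set.mem_iUnion₂.mp hnot
      exact Set.mem_biUnion (x := p) (by simp [s, hp]) hxp
  obtain ⟨p, hp, hle⟩ := (Ideal.subset_union_prime (f := id) (maximalIdeal R ^ 2)
    (maximalIdeal R ^ 2) (by
      intro i hi hne _
      simp only [s, Finset.mem_insert, hne, false_or, Set.Finite.mem_toFinset] at hi
      exact hi.isPrime)).mp hsub
  simp only [s, Finset.mem_insert, Set.Finite.mem_toFinset] at hp
  rcases hp with rfl | hp
  · exact h2 hle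
  · have : r ∈ ({r : R | IsSMulRegular M r}ᶜ : Set R) := by
      rw [← biUnion_associatedPrimes_eq_compl_regular]
      exact Set.mem_biUnion hp (hle hr)
    exact this hreg

lemma maximalIdeal_smul_top_lt_top {R : Type*} [CommRing R] [IsLocalRing R] (M : Type*)
    [AddCommGroup M] [Module R M] [Module.Finite R M] [Nontrivial M] :
    maximalIdeal R • (⊤ : Submodule R M) < ⊤ := by
  refine lt_top_iff_ne_top.mpr fun h => top_ne_bot (α := Submodule R M) ?_
  exact Submodule.eq_bot_of_le_smul_of_le_jacobson_bot (maximalIdeal R) ⊤ Module.Finite.fg_top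
    h.ge (maximalIdeal_le_jacobson _)

/-- A finite module of depth `N` over a local ring whose maximal ideal is generated by `N`
elements is free. -/
theorem free_of_extVanishesBelow (N : ℕ) :
    ∀ (R : Type) [CommRing R] [IsLocalRing R] [IsNoetherianRing R] (y : Fin N → R),
      Ideal.span (Set.range y) = maximalIdeal R →
      ∀ (M : Type) [AddCommGroup M] [Module R M] [Module.Finite R M],
        ExtVanishesBelow (maximalIdeal R) M N → Module.Free R M := by
  induction N with
  | zero =>
    intro R _ _ _ y hy M _ _ _ _
    have hbot : maximalIdeal R = ⊥ := by rw [← hy]; simp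
    let _ : Field R := (isField_iff_maximalIdeal_eq.mpr hbot).toField
    exact Module.Free.of_divisionRing R M
  | succ N ih =>
    intro R _ _ _ y hy M _ _ _ hM
    cases subsingleton_or_nontrivial M
    · infer_instance
    obtain ⟨rs, hlen, hmem, hreg⟩ := hM.exists_isRegular (maximalIdeal_smul_top_lt_top M)
    obtain ⟨r, rs, rfl⟩ := List.exists_cons_of_length_eq_add_one hlen
    rw [isRegular_cons_iff] at hreg
    -- Otherwise the maximal ideal is zero by Nakayama, and no element of it is regular on a nonzero
    -- module.
    have h2 : ¬ maximalIdeal R ≤ maximalIdeal R ^ 2 := by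
      intro h
      have hbot : maximalIdeal R = ⊥ :=
        Submodule.eq_bot_of_le_smul_of_le_jacobson_bot (maximalIdeal R) _
          (IsNoetherian.noetherian _) (by simpa [pow_two] using h) (maximalIdeal_le_jacobson _)
      have hr0 : r = 0 := by simpa [hbot] using hmem r (by simp)
      obtain ⟨v, hv⟩ := exists_ne (0 : M)
      exact hv (hreg.1.right_eq_zero_of_smul (by simp [hr0]))
    -- Modulo `x`, the number of generators of the maximal ideal and the depth both drop by one, and
    -- freeness of `M/xM` over `R/(x)` lifts to `M`.
    obtain ⟨x, hx, hx2, hxreg⟩ :=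
      exists_isSMulRegular_notMem_sq (hmem r (by simp)) hreg.1 h2
    obtain ⟨z, hz⟩ := span_range_quotient_of_notMem_sq hy hx hx2
    have : Nontrivial (R ⧸ Ideal.span {x}) := Ideal.Quotient.nontrivial_iff.mpr
      (ne_top_of_le_ne_top (maximalIdeal.isMaximal R).ne_top (by simpa using hx))
    have hlocal : IsLocalRing (R ⧸ Ideal.span {x}) :=
      .of_surjective' (Ideal.Quotient.mk _) Ideal.Quotient.mk_surjective
    have hmax : (maximalIdeal R).map (Ideal.Quotient.mk (Ideal.span {x})) =
        maximalIdeal (R ⧸ Ideal.span {x}) :=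
      map_maximalIdeal_of_surjective _ Ideal.Quotient.mk_surjective
    have : Module.Finite (R ⧸ Ideal.span {x}) (QuotSMulTop x M) :=
      Module.Finite.of_restrictScalars_finite R _ _
    have := nontrivial_quotSMulTop_of_mem_maximalIdeal (L := M) hx
    -- Ext over `R` and Ext over `R/(x)` are different groups; a regular sequence carries the depth
    -- from one ring to the other.
    obtain ⟨ss, hslen, hsmem, hsreg⟩ := (hM.quotSMulTop hxreg).exists_isRegular
      (maximalIdeal_smul_top_lt_top (QuotSMulTop x M))
    have hsreg' : IsWeaklyRegular (QuotSMulTop x M) (ss.map (algebraMap R (R ⧸ Ideal.span {x}))) :=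
      (isWeaklyRegular_map_algebraMap_iff _ _ ss).mpr hsreg.1
    have hsmem' : ∀ t ∈ ss.map (algebraMap R (R ⧸ Ideal.span {x})), t ∈ maximalIdeal _ := by
      intro t ht
      obtain ⟨s, hs, rfl⟩ := List.mem_map.mp ht
      rw [← hmax]
      exact Ideal.mem_map_of_mem _ (hsmem s hs)
    have hdepth := extVanishesBelow_of_isRegular (P := maximalIdeal (R ⧸ Ideal.span {x}))
      (maximalIdeal_smul_top_lt_top (QuotSMulTop x M)) _ hsmem'
      (RingTheory.Sequence.IsRegular.of_isWeaklyRegular_of_mem_maximalIdeal _ hsmem' hsreg')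
    rw [List.length_map, hslen] at hdepth
    have hfree := ih (R ⧸ Ideal.span {x}) z (hz.trans hmax) (QuotSMulTop x M) hdepth
    have : Module.FinitePresentation R M := Module.finitePresentation_of_finite R M
    exact (Module.free_quotSMulTop_iff_free R M (maximalIdeal_le_jacobson _ hx) hxreg).mp hfree

/-- A finite generating family of a projective module over a local ring, all of whose relations
have coefficients in the maximal ideal, is linearly independent. -/
lemma linearIndependent_of_relations {R : Type*} [CommRing R] [IsLocalRing R] {M : Type*}
    [AddCommGroup M] [Module R M] [Module.Projective R M] {κ : Type*} [Fintype κ] (v : κ → M)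
    (hspan : Submodule.span R (Set.range v) = ⊤)
    (hrel : ∀ c : κ → R, ∑ i, c i • v i = 0 → ∀ i, c i ∈ maximalIdeal R) :
    LinearIndependent R v := by
  classical
  let φ := Fintype.linearCombination R v
  have hφ : Function.Surjective φ := by
    rw [← LinearMap.range_eq_top, Fintype.range_linearCombination, hspan]
  obtain ⟨s, hs⟩ := Module.projective_lifting_property φ LinearMap.id hφ
  -- The projection onto the relation module `K`, which is a direct summand. For `w ∈ K`, `w = π w =
  -- ∑ wᵢ π(eᵢ)` with each `wᵢ` in the maximal ideal, so `K` is zero by Nakayama.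
  let π : (κ → R) →ₗ[R] (κ → R) := LinearMap.id - s ∘ₗ φ
  have hπ : LinearMap.range π = LinearMap.ker φ := by
    ext w
    constructor
    · rintro ⟨w, rfl⟩
      have := LinearMap.congr_fun hs (φ w)
      simp only [LinearMap.comp_apply, LinearMap.id_apply] at this
      simp [π, this]
    · intro hw
      exact ⟨w, by simp [π, LinearMap.mem_ker.mp hw]⟩
  have hker : LinearMap.ker φ = ⊥ := by
    refine Submodule.eq_bot_of_le_smul_of_le_jacobson_bot (maximalIdeal R) _ ?_ ?_
      (maximalIdeal_le_jacobson _)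
    · rw [← hπ, LinearMap.range_eq_map]
      exact Module.Finite.fg_top.map _
    · intro w hw
      have hw' : w = ∑ i, w i • π (Pi.single i 1) := by
        have : π w = w := by simp [π, LinearMap.mem_ker.mp hw]
        conv_lhs => rw [← this, ← Finset.univ_sum_single w]
        rw [map_sum]
        refine Finset.sum_congr rfl fun i _ => ?_
        rw [← map_smul, ← Pi.single_smul, smul_eq_mul, mul_one]
      rw [hw']
      refine Submodule.sum_mem _ fun i _ => Submodule.smul_mem_smul ?_ (hπ ▸ ⟨_, rfl⟩)
      exact hrel w (by simpa [φ, Fintype.linearCombination_apply] using hw) i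
  rw [Fintype.linearIndependent_iff]
  intro c hc
  have : c ∈ LinearMap.ker φ := by simpa [φ, Fintype.linearCombination_apply] using hc
  rw [hker, Submodule.mem_bot] at this
  exact fun i => congrFun this i

end Free
end ACMHypersurface

namespace ACMHypersurface
-- Homogeneous components and minimal generators.
section Graded

attribute [local instance] MvPolynomial.gradedAlgebra

variable {n : ℕ}

lemma mem_irrelevantIdeal_iff {p : CoordRing n} :
    p ∈ irrelevantIdeal n ↔ constantCoeff p = 0 := by
  rw [irrelevantIdeal, ← Set.image_univ, mem_ideal_span_X_image, constantCoeff_eq]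
  constructor
  · intro h
    by_contra h0
    obtain ⟨i, -, hi⟩ := h 0 (mem_support_iff.mpr h0)
    simp at hi
  · intro h m hm
    by_contra! hcon
    have : m = 0 := by ext i; simpa using hcon i
    rw [this, mem_support_iff] at hm
    exact hm h

instance irrelevantIdeal_isMaximal (n : ℕ) : (irrelevantIdeal n).IsMaximal := by
  have : irrelevantIdeal n = RingHom.ker (constantCoeff (R := ℂ) (σ := Fin (n + 1))) := by
    ext p; simp [mem_irrelevantIdeal_iff]
  rw [this]
  exact RingHom.ker_isMaximal_of_surjective _ fun c => ⟨C c, by simp⟩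

/-- The homogeneous component of integral degree `e` of a polynomial. -/
noncomputable def hcomp (e : ℤ) : CoordRing n →ₗ[ℂ] CoordRing n :=
  if 0 ≤ e then homogeneousComponent e.toNat else 0

lemma coeff_hcomp (e : ℤ) (p : CoordRing n) (m : Fin (n + 1) →₀ ℕ) :
    coeff m (hcomp e p) = if ((m.degree : ℕ) : ℤ) = e then coeff m p else 0 := by
  unfold hcomp
  split_ifs with h1 h2 h2
  · rw [coeff_homogeneousComponent, if_pos (by omega)]
  · rw [coeff_homogeneousComponent, if_neg (by omega)]
  · omega
  · simp

lemma isHomogeneousOfDegree_hcomp (e : ℤ) (p : CoordRing n) :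
    IsHomogeneousOfDegree (hcomp e p) e := by
  intro m hm
  rw [coeff_hcomp] at hm
  by_contra h
  simp [h] at hm

lemma IsHomogeneousOfDegree.hcomp_eq {p : CoordRing n} {a : ℤ} (h : IsHomogeneousOfDegree p a)
    (e : ℤ) : hcomp e p = if e = a then p else 0 := by
  ext m
  rw [coeff_hcomp]
  by_cases hm : coeff m p = 0
  · split_ifs <;> simp [hm]
  · rw [h m hm]
    by_cases hea : e = a
    · simp [hea]
    · simp [hea, Ne.symm hea]

lemma IsHomogeneousOfDegree.mul {p q : CoordRing n} {a b : ℤ} (hp : IsHomogeneousOfDegree p a)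
    (hq : IsHomogeneousOfDegree q b) : IsHomogeneousOfDegree (p * q) (a + b) := by
  intro m hm
  rw [coeff_mul] at hm
  obtain ⟨⟨x, y⟩, hxy, hne⟩ := Finset.exists_ne_zero_of_sum_ne_zero hm
  rw [Finset.HasAntidiagonal.mem_antidiagonal] at hxy
  rw [← hp x (left_ne_zero_of_mul hne), ← hq y (right_ne_zero_of_mul hne), ← hxy]
  simp

lemma isHomogeneousOfDegree_monomial (m : Fin (n + 1) →₀ ℕ) (c : ℂ) :
    IsHomogeneousOfDegree (monomial m c : CoordRing n) m.degree := by
  intro m' hm'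
  rw [coeff_monomial] at hm'
  by_cases h : m = m'
  · rw [h]
  · simp [h] at hm'

lemma isHomogeneousOfDegree_natCast_iff {p : CoordRing n} {d : ℕ} :
    IsHomogeneousOfDegree p d ↔ p.IsHomogeneous d := by
  simp only [IsHomogeneousOfDegree, MvPolynomial.IsHomogeneous, IsWeightedHomogeneous]
  refine forall₂_congr fun m _ => ?_
  rw [Nat.cast_inj, Finsupp.degree_eq_weight_one]
  rfl

lemma IsHomogeneousOfDegree.exists_isHomogeneous {p : CoordRing n} {a : ℤ}
    (h : IsHomogeneousOfDegree p a) : ∃ m : ℕ, p.IsHomogeneous m := by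
  rcases le_or_gt 0 a with ha | ha
  · lift a to ℕ using ha
    exact ⟨a, isHomogeneousOfDegree_natCast_iff.mp h⟩
  · refine ⟨0, ?_⟩
    have : p = 0 := by
      ext m
      by_contra hm
      have := h m (by simpa using hm)
      omega
    rw [this]
    exact isHomogeneous_zero _ _ _

lemma IsHomogeneousOfDegree.mem_irrelevantIdeal {p : CoordRing n} {a : ℤ}
    (h : IsHomogeneousOfDegree p a) (ha : a ≠ 0) : p ∈ irrelevantIdeal n := by
  rw [mem_irrelevantIdeal_iff, constantCoeff_eq]
  by_contra h0
  exact ha (by simpa using (h 0 h0).symm)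

/-- Negative degree leaves only zero, and degree zero leaves a constant. This supplies the zero
entries required of a weak determinantal matrix where `aᵢ ≥ bⱼ`. -/
lemma IsHomogeneousOfDegree.eq_zero_of_nonpos {p : CoordRing n} {a : ℤ}
    (h : IsHomogeneousOfDegree p a) (ha : a ≤ 0) (hp : p ∈ irrelevantIdeal n) : p = 0 := by
  ext m
  by_contra hm
  have hm' : coeff m p ≠ 0 := by simpa using hm
  have hdeg := h m hm'
  have : m.degree = 0 := by omega
  rw [Finsupp.degree_eq_zero_iff] at this
  rw [mem_irrelevantIdeal_iff, constantCoeff_eq] at hp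
  exact hm' (this ▸ hp)

lemma hcomp_mul {p : CoordRing n} {a : ℤ} (hp : IsHomogeneousOfDegree p a) (e : ℤ)
    (q : CoordRing n) : hcomp e (q * p) = hcomp (e - a) q * p := by
  induction q using MvPolynomial.induction_on' with
  | monomial u c =>
    have hu := isHomogeneousOfDegree_monomial u c
    rw [(hu.mul hp).hcomp_eq, hu.hcomp_eq]
    by_cases h : e = u.degree + a
    · rw [if_pos h, if_pos (by omega)]
    · rw [if_neg h, if_neg (by omega), zero_mul]
  | add p q hp hq => rw [add_mul, map_add, hp, hq, map_add, add_mul]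

lemma hcomp_zero_eq (p : CoordRing n) : hcomp 0 p = C (constantCoeff p) := by
  ext m
  rw [coeff_hcomp, coeff_C, constantCoeff_eq]
  by_cases h : m = 0
  · simp [h]
  · have : m.degree ≠ 0 := by rwa [Ne, Finsupp.degree_eq_zero_iff]
    rw [if_neg (by exact_mod_cast this), if_neg (Ne.symm h)]

variable {ι : Type} [Fintype ι]

/-- `v` is homogeneous of degree `e` in the graded free module `⨁ᵢ S(-αᵢ)`. -/
def IsHomogeneousVector (α : ι → ℤ) (e : ℤ) (v : ι → CoordRing n) : Prop :=
  ∀ i, IsHomogeneousOfDegree (v i) (e - α i)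

/-- The component of degree `e` of an element of the graded free module `⨁ᵢ S(-αᵢ)`. -/
noncomputable def vectorComponent (α : ι → ℤ) (e : ℤ) (v : ι → CoordRing n) : ι → CoordRing n :=
  fun i => hcomp (e - α i) (v i)

omit [Fintype ι] in
lemma vectorComponent_sum {κ : Type*} (s : Finset κ) (α : ι → ℤ) (e : ℤ)
    (v : κ → ι → CoordRing n) :
    vectorComponent α e (∑ j ∈ s, v j) = ∑ j ∈ s, vectorComponent α e (v j) := by
  ext1 i
  simp [vectorComponent, Finset.sum_apply]

omit [Fintype ι] in
lemma vectorComponent_smul {α : ι → ℤ} {b : ℤ} {v : ι → CoordRing n}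
    (hv : IsHomogeneousVector α b v) (e : ℤ) (q : CoordRing n) :
    vectorComponent α e (q • v) = hcomp (e - b) q • v := by
  ext1 i
  simp only [vectorComponent, Pi.smul_apply, smul_eq_mul]
  rw [hcomp_mul (hv i), sub_sub_sub_cancel_right]

lemma exists_finset_sum_vectorComponent (α : ι → ℤ) (v : ι → CoordRing n) :
    ∃ E : Finset ℤ, v = ∑ e ∈ E, vectorComponent α e v := by
  classical
  let E : Finset ℤ := Finset.univ.biUnion fun i =>
    (v i).support.image fun m => ((m.degree : ℕ) : ℤ) + α i
  refine ⟨E, ?_⟩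
  ext i m
  rw [Finset.sum_apply, coeff_sum]
  simp only [vectorComponent, coeff_hcomp]
  by_cases hm : coeff m (v i) = 0
  · simp [hm]
  · have hE : ((m.degree : ℕ) : ℤ) + α i ∈ E :=
      Finset.mem_biUnion.mpr ⟨i, Finset.mem_univ _, Finset.mem_image.mpr
        ⟨m, mem_support_iff.mpr hm, rfl⟩⟩
    rw [Finset.sum_eq_single_of_mem _ hE]
    · simp
    · intro e _ hne
      rw [if_neg (by omega)]

/-- A finitely generated graded submodule of a graded free module has a minimal homogeneous
system of generators: all relations have coefficients in the irrelevant ideal. -/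
theorem exists_minimal_generators (α : ι → ℤ) (K : Submodule (CoordRing n) (ι → CoordRing n))
    (hK : ∀ v ∈ K, ∀ e, vectorComponent α e v ∈ K) :
    ∃ (r : ℕ) (β : Fin r → ℤ) (k : Fin r → ι → CoordRing n),
      (∀ j, IsHomogeneousVector α (β j) (k j)) ∧
      Submodule.span (CoordRing n) (Set.range k) = K ∧
      ∀ c : Fin r → CoordRing n, ∑ j, c j • k j = 0 → ∀ j, c j ∈ irrelevantIdeal n := by
  classical
  let p : ℕ → Prop := fun r => ∃ (β : Fin r → ℤ) (k : Fin r → ι → CoordRing n),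
    (∀ j, IsHomogeneousVector α (β j) (k j)) ∧ Submodule.span (CoordRing n) (Set.range k) = K
  have hex : ∃ r, p r := by
    obtain ⟨t, ht⟩ := IsNoetherian.noetherian K
    choose E hE using exists_finset_sum_vectorComponent (n := n) α
    let T : Finset (ι → CoordRing n) := t.biUnion fun v => (E v).image fun e => vectorComponent α e v
    have hT : ∀ w : T, ∃ e, IsHomogeneousVector α e w.1 := by
      rintro ⟨w, hw⟩
      simp only [T, Finset.mem_biUnion, Finset.mem_image] at hw
      obtain ⟨v, -, e, -, rfl⟩ := hw
      exact ⟨e, fun i => isHomogeneousOfDegree_hcomp _ _⟩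
    choose b hb using hT
    refine ⟨T.card, fun j => b (T.equivFin.symm j), fun j => (T.equivFin.symm j).1,
      fun j => hb _, ?_⟩
    have hrange : Set.range (fun j => (T.equivFin.symm j).1) = (T : Set (ι → CoordRing n)) := by
      rw [Set.range_comp' Subtype.val T.equivFin.symm, T.equivFin.symm.surjective.range_eq,
        Set.image_univ, Subtype.range_coe]
    rw [hrange]
    apply le_antisymm
    · rw [Submodule.span_le]
      intro w hw
      simp only [T, Finset.mem_coe, Finset.mem_biUnion, Finset.mem_image] at hw
      obtain ⟨v, hv, e, -, rfl⟩ := hw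
      exact hK v (ht ▸ Submodule.subset_span hv) e
    · rw [← ht, Submodule.span_le]
      intro v hv
      rw [SetLike.mem_coe, hE v]
      refine Submodule.sum_mem _ fun e he => Submodule.subset_span ?_
      simp only [T, Finset.mem_coe, Finset.mem_biUnion, Finset.mem_image]
      exact ⟨v, hv, e, he, rfl⟩
  -- The number `r` of homogeneous generators is taken as small as possible.
  obtain ⟨β, k, hhom, hspan⟩ := Nat.find_spec hex
  have hmin : ∀ r, p r → Nat.find hex ≤ r := fun r h => Nat.find_min' hex h
  generalize Nat.find hex = r at β k hhom hspan hmin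
  refine ⟨r, β, k, hhom, hspan, fun c hc j₀ => ?_⟩
  by_contra hj
  obtain ⟨r, rfl⟩ : ∃ r', r = r' + 1 := ⟨r - 1, by have := j₀.2; omega⟩
  refine absurd (hmin r ⟨fun j => β (j₀.succAbove j), fun j => k (j₀.succAbove j),
    fun j => hhom _, ?_⟩) (by omega)
  -- In the component of degree `β j₀` of the relation, the coefficient of `k j₀` is its constant
  -- term. This is nonzero, so `k j₀` is redundant, against the choice of `r`.
  have hrel : ∑ j, hcomp (β j₀ - β j) (c j) • k j = 0 := by
    have := congrArg (vectorComponent α (β j₀)) hc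
    rw [vectorComponent_sum] at this
    simp_rw [fun j => vectorComponent_smul (hhom j)] at this
    rw [this]
    ext1 i
    simp [vectorComponent]
  rw [Fin.sum_univ_succAbove _ j₀, sub_self, hcomp_zero_eq] at hrel
  rw [mem_irrelevantIdeal_iff] at hj
  have hk : k j₀ ∈ Submodule.span (CoordRing n) (Set.range fun j => k (j₀.succAbove j)) := by
    have : k j₀ = (-C (constantCoeff (c j₀))⁻¹ : CoordRing n) •
        ∑ j, hcomp (β j₀ - β (j₀.succAbove j)) (c (j₀.succAbove j)) • k (j₀.succAbove j) := by
      rw [eq_neg_of_add_eq_zero_right hrel, neg_smul_neg, smul_smul, ← C_mul, inv_mul_cancel₀ hj,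
        C_1, one_smul]
    rw [this]
    exact Submodule.smul_mem _ _ (Submodule.sum_mem _ fun j _ =>
      Submodule.smul_mem _ _ (Submodule.subset_span ⟨j, rfl⟩))
  rw [← hspan]
  apply le_antisymm
  · refine Submodule.span_mono ?_
    rintro _ ⟨j, rfl⟩
    exact ⟨_, rfl⟩
  · rw [Submodule.span_le]
    rintro _ ⟨j, rfl⟩
    rcases Fin.eq_self_or_eq_succAbove j₀ j with rfl | ⟨j, rfl⟩
    · exact hk
    · exact Submodule.subset_span ⟨j, rfl⟩

/-- A homogeneous family of generators of an ideal, all of whose relations have coefficients in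
the irrelevant ideal. -/
structure IsMinimalFamily (I : Ideal (CoordRing n)) (α : ι → ℤ) (g : ι → CoordRing n) : Prop where
  homogeneous : ∀ i, IsHomogeneousOfDegree (g i) (α i)
  span_eq : Ideal.span (Set.range g) = I
  relations : ∀ c : ι → CoordRing n, ∑ i, c i * g i = 0 → ∀ i, c i ∈ irrelevantIdeal n

/-- An ideal closed under taking homogeneous components. -/
def IsGradedIdeal (I : Ideal (CoordRing n)) : Prop := ∀ p ∈ I, ∀ e, hcomp e p ∈ I

lemma isGradedIdeal_toIdeal (J : HomogeneousIdeal (homogeneousSubmodule (Fin (n + 1)) ℂ)) :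
    IsGradedIdeal J.toIdeal := by
  intro p hp e
  unfold hcomp
  split_ifs with he
  · have := J.isHomogeneous e.toNat hp
    rwa [← DirectSum.Decomposition.decompose'_eq, decomposition.decompose'_apply] at this
  · simp

lemma IsGradedIdeal.le_irrelevantIdeal {I : Ideal (CoordRing n)} (hI : IsGradedIdeal I)
    (htop : I ≠ ⊤) : I ≤ irrelevantIdeal n := by
  intro p hp
  rw [mem_irrelevantIdeal_iff]
  by_contra h0
  have := hI p hp 0
  rw [hcomp_zero_eq] at this
  exact htop (Ideal.eq_top_of_isUnit_mem _ this ((isUnit_iff_ne_zero.mpr h0).map C))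

lemma IsGradedIdeal.exists_isMinimalFamily {I : Ideal (CoordRing n)} (hI : IsGradedIdeal I) :
    ∃ (r : ℕ) (α : Fin r → ℤ) (g : Fin r → CoordRing n), IsMinimalFamily I α g := by
  -- The ideal is viewed as a graded submodule of the free module of rank one with generator in
  -- degree zero.
  obtain ⟨r, β, k, hhom, hspan, hrel⟩ := exists_minimal_generators (ι := Unit) (fun _ => 0)
    (Submodule.comap (LinearMap.proj (R := CoordRing n) (φ := fun _ : Unit => CoordRing n) ()) I)
    (fun v hv e => hI _ hv _)
  refine ⟨r, β, fun j => k j (), fun j => by simpa using hhom j (), ?_, ?_⟩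
  · have := congrArg (Submodule.map
      (LinearMap.proj (R := CoordRing n) (φ := fun _ : Unit => CoordRing n) ())) hspan
    rw [Submodule.map_span, Submodule.map_comap_eq_of_surjective
      (LinearMap.proj_surjective ()), ← Set.range_comp] at this
    exact this
  · intro c hc
    refine hrel c ?_
    ext1 i
    simpa [Finset.sum_apply] using hc

lemma isGradedIdeal_span {G : Set (CoordRing n)} (hG : ∀ g ∈ G, ∃ m : ℕ, g.IsHomogeneous m) :
    IsGradedIdeal (Ideal.span G) := by
  intro p hp e
  induction hp using Submodule.span_induction generalizing e with
  | zero => simp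
  | add p q _ _ hp hq => rw [map_add]; exact add_mem (hp e) (hq e)
  | mem p hp =>
    obtain ⟨m, hm⟩ := hG p hp
    rw [(isHomogeneousOfDegree_natCast_iff.mpr hm).hcomp_eq]
    split_ifs
    · exact Ideal.subset_span hp
    · simp
  | smul a p _ hp =>
    obtain ⟨E, hE⟩ := exists_finset_sum_vectorComponent (ι := Unit) (fun _ => 0) fun _ => p
    have hE' : p = ∑ e ∈ E, hcomp e p := by
      have := congrFun hE ()
      simpa [Finset.sum_apply, vectorComponent] using this
    rw [hE', smul_eq_mul, Finset.mul_sum, map_sum]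
    refine Ideal.sum_mem _ fun b _ => ?_
    rw [hcomp_mul (isHomogeneousOfDegree_hcomp b p)]
    exact Ideal.mul_mem_left _ _ (hp b)

section MinimalGenerators

variable {I : Ideal (CoordRing n)} {α : ι → ℤ} {g : ι → CoordRing n}

lemma IsMinimalFamily.exists_homogeneous_coeffs (h : IsMinimalFamily I α g) {F : CoordRing n}
    {d : ℤ} (hF : IsHomogeneousOfDegree F d) (hFI : F ∈ I) :
    ∃ c : ι → CoordRing n, (∀ i, IsHomogeneousOfDegree (c i) (d - α i)) ∧ F = ∑ i, c i * g i := by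
  rw [← h.span_eq, Ideal.mem_span_range_iff_exists_fun] at hFI
  obtain ⟨c, hc⟩ := hFI
  refine ⟨fun i => hcomp (d - α i) (c i), fun i => isHomogeneousOfDegree_hcomp _ _, ?_⟩
  have := congrArg (hcomp d) hc
  rw [hF.hcomp_eq, if_pos rfl, map_sum] at this
  rw [← this]
  exact Finset.sum_congr rfl fun i _ => hcomp_mul (h.homogeneous i) d (c i)

/-- A member of a minimal family may be exchanged for a homogeneous element of the ideal whose
coefficient at this member is not in the irrelevant ideal. -/
lemma IsMinimalFamily.update [DecidableEq ι] (h : IsMinimalFamily I α g) {F : CoordRing n}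
    {d : ℤ} (hF : IsHomogeneousOfDegree F d) {c : ι → CoordRing n}
    (hc : ∀ i, IsHomogeneousOfDegree (c i) (d - α i)) (hFc : F = ∑ i, c i * g i) {i₀ : ι}
    (hi₀ : c i₀ ∉ irrelevantIdeal n) :
    α i₀ = d ∧ IsMinimalFamily I α (Function.update g i₀ F) := by
  -- A form outside the irrelevant ideal has degree zero, so `c i₀` is a nonzero constant.
  have hd : α i₀ = d := by
    by_contra hne
    exact hi₀ ((hc i₀).mem_irrelevantIdeal (by omega))
  have hgI : ∀ i, g i ∈ I := fun i => h.span_eq ▸ Ideal.subset_span ⟨i, rfl⟩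
  refine ⟨hd, ?_, ?_, ?_⟩
  · intro i
    by_cases hi : i = i₀
    · subst hi; simpa [hd] using hF
    · simpa [hi] using h.homogeneous i
  · apply le_antisymm
    · rw [Ideal.span_le]
      rintro _ ⟨i, rfl⟩
      by_cases hi : i = i₀
      · subst hi
        simp only [Function.update_self, SetLike.mem_coe, hFc]
        exact Ideal.sum_mem _ fun i _ => Ideal.mul_mem_left _ _ (hgI i)
      · simpa [hi] using hgI i
    · rw [← h.span_eq, Ideal.span_le]
      have hmem : ∀ i, i ≠ i₀ → g i ∈ Ideal.span (Set.range (Function.update g i₀ F)) :=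
        fun i hi => Ideal.subset_span ⟨i, by simp [hi]⟩
      rintro _ ⟨i, rfl⟩
      by_cases hi : i = i₀
      · subst hi
        have hu : hcomp 0 (c i) = c i := by
          rw [(hc i).hcomp_eq, if_pos (by omega)]
        rw [hcomp_zero_eq] at hu
        rw [mem_irrelevantIdeal_iff] at hi₀
        have hone : (C (constantCoeff (c i))⁻¹ : CoordRing n) * c i = 1 := by
          conv_lhs => rw [← hu]
          rw [constantCoeff_C, ← C_mul, inv_mul_cancel₀ hi₀, C_1]
        have hg : g i = C (constantCoeff (c i))⁻¹ * (F - ∑ j ∈ Finset.univ.erase i, c j * g j) := by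
          rw [hFc, ← Finset.add_sum_erase _ _ (Finset.mem_univ i)]
          linear_combination -(g i) * hone
        rw [SetLike.mem_coe, hg]
        refine Ideal.mul_mem_left _ _ (sub_mem (Ideal.subset_span ⟨i, by simp⟩) ?_)
        exact Ideal.sum_mem _ fun j hj =>
          Ideal.mul_mem_left _ _ (hmem j (Finset.ne_of_mem_erase hj))
      · exact hmem i hi
  · intro e he
    -- Expanding `F` turns a relation of the new family into one of the old. Its coefficient at `i₀`
    -- is `e i₀ * c i₀`, so primality gives `e i₀` in the irrelevant ideal, and then the other
    -- coefficients follow.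
    have hsum : ∑ i, ((if i = i₀ then 0 else e i) + e i₀ * c i) * g i = 0 := by
      simp_rw [add_mul, Finset.sum_add_distrib, mul_assoc, ← Finset.mul_sum, ← hFc]
      rw [← Finset.add_sum_erase _ _ (Finset.mem_univ i₀)] at he ⊢
      rw [Finset.sum_congr rfl (g := fun i => e i * Function.update g i₀ F i)]
      · simp only [Function.update_self] at he
        simp only [if_true, zero_mul, zero_add]
        linear_combination he
      · intro i hi
        simp [Finset.ne_of_mem_erase hi]
    have hrel := h.relations _ hsum
    have h0 : e i₀ ∈ irrelevantIdeal n := by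
      have := hrel i₀
      simp only [if_true, zero_add] at this
      exact ((irrelevantIdeal_isMaximal n).isPrime.mem_or_mem this).resolve_right hi₀
    intro i
    by_cases hi : i = i₀
    · exact hi ▸ h0
    · have := hrel i
      simp only [hi, if_false] at this
      exact (Ideal.add_mem_iff_left _ (Ideal.mul_mem_right _ _ h0)).mp this

/-- If some `g i` were redundant, there would be a relation with coefficient `-1` at `i`, and `-1`
is not in the irrelevant ideal. -/
lemma IsMinimalFamily.hasMinimalGenerator {Y : ClosedSubscheme n}
    (h : IsMinimalFamily Y.ideal.toIdeal α g) (i₀ : ι) : Y.HasMinimalGenerator (g i₀) := by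
  classical
  refine ⟨Set.range g, ?_, h.span_eq, ?_, ⟨i₀, rfl⟩⟩
  · rintro _ ⟨i, rfl⟩
    exact (h.homogeneous i).exists_isHomogeneous
  · rintro _ ⟨i, rfl⟩ hspan
    have hi : g i ∈ Ideal.span (Set.range g \ {g i}) := by
      rw [hspan, ← h.span_eq]
      exact Ideal.subset_span ⟨i, rfl⟩
    have hle : Ideal.span (Set.range g \ {g i}) ≤
        Ideal.span (Set.range (Function.update g i 0)) := by
      refine Ideal.span_mono ?_
      rintro _ ⟨⟨j, rfl⟩, hj⟩
      have hji : j ≠ i := fun hji => hj (by rw [hji]; rfl)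
      exact ⟨j, by simp [hji]⟩
    obtain ⟨c, hc⟩ := Ideal.mem_span_range_iff_exists_fun.mp (hle hi)
    have := h.relations (Function.update c i (-1)) (by
      rw [← Finset.add_sum_erase _ _ (Finset.mem_univ i)] at hc ⊢
      rw [Finset.sum_congr rfl (g := fun j => c j * Function.update g i 0 j)]
      · simp only [Function.update_self, mul_zero, zero_add] at hc ⊢
        rw [hc]
        ring
      · intro j hj
        simp [Finset.ne_of_mem_erase hj]) i
    rw [Function.update_self] at this
    rw [mem_irrelevantIdeal_iff] at this
    simp at this

/-- Graded Nakayama for a possibly infinite generating set `G` containing `F`: multiples of `F` by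
elements without constant term have no component in degree `d`, so `F` is the degree-`d` component
of an element of the ideal spanned by `G \ {F}`. -/
lemma not_hasMinimalGenerator_of_mem_mul {Y : ClosedSubscheme n} {F : CoordRing n} {d : ℤ}
    (hF : IsHomogeneousOfDegree F d) (hmem : F ∈ irrelevantIdeal n * Y.ideal.toIdeal) :
    ¬ Y.HasMinimalGenerator F := by
  rintro ⟨G, hG, hspan, hmin, hFG⟩
  have hGF : G = insert F (G \ {F}) := by simp [Set.insert_eq_of_mem hFG]
  have hJ := isGradedIdeal_span (G := G \ {F}) fun g hg => hG g hg.1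
  rw [← hspan] at hmem
  have hspan' : Ideal.span G = Ideal.span {F} ⊔ Ideal.span (G \ {F}) := by
    rw [← Ideal.span_insert, ← hGF]
  rw [hspan', Ideal.mul_sup] at hmem
  obtain ⟨x, hx, y, hy, hxy⟩ := Submodule.mem_sup.mp hmem
  have hy' : y ∈ Ideal.span (G \ {F}) := Ideal.mul_le_right (I := irrelevantIdeal n) hy
  rw [mul_comm, Ideal.mem_span_singleton_mul] at hx
  obtain ⟨u, hu, rfl⟩ := hx
  have hcomp_eq : F = hcomp d y := by
    have := congrArg (hcomp d) hxy
    rw [map_add, mul_comm, hcomp_mul hF, sub_self, hcomp_zero_eq,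
      mem_irrelevantIdeal_iff.mp hu, C_0, zero_mul, zero_add, hF.hcomp_eq, if_pos rfl] at this
    exact this.symm
  have hFJ : F ∈ Ideal.span (G \ {F}) := by
    have hmem' := hJ y hy' d
    rw [← hcomp_eq] at hmem'
    exact hmem'
  refine hmin F hFG ?_
  rw [← hspan, hspan']
  exact (sup_eq_right.mpr ((Ideal.span_singleton_le_iff_mem _).mpr hFJ)).symm

end MinimalGenerators

end Graded
end ACMHypersurface

namespace ACMHypersurface
-- Freeness of the syzygies of an ACM ideal, by localization.
section Syzygies
open RingTheory.Sequence Pointwise IsLocalRing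

lemma extVanishesBelow_localization (n : ℕ) :
    ExtVanishesBelow (maximalIdeal (Localization.AtPrime (irrelevantIdeal n)))
      (Localization.AtPrime (irrelevantIdeal n)) (n + 1) := by
  have hmem : ∀ r ∈ translatedVariables (n := n) 0, r ∈ irrelevantIdeal n := by
    intro r hr
    obtain ⟨i, rfl⟩ := (List.mem_ofFn' _ _).mp hr
    simp [mem_irrelevantIdeal_iff]
  have h := (isWeaklyRegular_translatedVariables (n := n) 0).isRegular_of_isLocalization_of_mem
    (Localization.AtPrime (irrelevantIdeal n)) (irrelevantIdeal n) hmem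
  have := extVanishesBelow_of_isRegular (maximalIdeal_smul_top_lt_top _) _ (by
    intro r hr
    obtain ⟨s, hs, rfl⟩ := List.mem_map.mp hr
    exact (IsLocalization.AtPrime.to_map_mem_maximal_iff _ (irrelevantIdeal n) s).mpr
      (hmem s hs)) h
  simpa [translatedVariables] using this

lemma exists_span_range_eq_maximalIdeal_localization (n : ℕ) :
    ∃ y : Fin (n + 1) → Localization.AtPrime (irrelevantIdeal n),
      Ideal.span (Set.range y) = maximalIdeal _ := by
  refine ⟨fun i => algebraMap (CoordRing n) _ (X i), ?_⟩
  rw [← Localization.AtPrime.map_eq_maximalIdeal]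
  conv_rhs => unfold irrelevantIdeal
  rw [Ideal.map_span, ← Set.range_comp]
  rfl

section SurjectiveLocal

variable {R A : Type} [CommRing R] [IsLocalRing R] [CommRing A] [Algebra R A]

/-- A regular sequence in a local quotient ring of `R` gives vanishing of `Ext` over `R`. -/
lemma extVanishesBelow_of_surjective [IsNoetherianRing R] [IsLocalRing A]
    (hsurj : Function.Surjective (algebraMap R A)) (rs : List A)
    (hrs : IsRegular A rs) : ExtVanishesBelow (maximalIdeal R) A rs.length := by
  have hloc : IsLocalHom (algebraMap R A) := IsLocalHom.of_surjective _ hsurj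
  have : Module.Finite R A := Module.Finite.of_surjective (Algebra.linearMap R A) hsurj
  obtain ⟨ss, rfl⟩ := List.map_surjective_iff.mpr hsurj rs
  have hmem : ∀ s ∈ ss, s ∈ maximalIdeal R := by
    intro s hs
    by_contra h
    have hu : IsUnit (algebraMap R A s) := (by simpa using h : IsUnit s).map _
    refine hrs.2 ?_
    have : Ideal.ofList (ss.map (algebraMap R A)) = ⊤ :=
      Ideal.eq_top_of_isUnit_mem _ (Ideal.subset_span (List.mem_map_of_mem hs)) hu
    rw [this]
    simp
  have hw := (isWeaklyRegular_map_algebraMap_iff A A ss).mp hrs.1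
  have := extVanishesBelow_of_isRegular (maximalIdeal_smul_top_lt_top A) ss hmem
    (IsRegular.of_isWeaklyRegular_of_mem_maximalIdeal _ hmem hw)
  simpa using this

variable {ι : Type} [Fintype ι]

/-- The depth count in the reverse direction: passing from the quotient to the ideal gains one unit,
and from the ideal to its syzygies another. -/
lemma extVanishesBelow_ker_of_surjective (hsurj : Function.Surjective (algebraMap R A)) {d : ℕ}
    (hR : ExtVanishesBelow (maximalIdeal R) R (d + 2)) (hA : ExtVanishesBelow (maximalIdeal R) A d)
    (ψ : (ι → R) →ₗ[R] R) (hψ : LinearMap.range ψ = LinearMap.ker (Algebra.linearMap R A)) :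
    ExtVanishesBelow (maximalIdeal R) (LinearMap.ker ψ) (d + 2) := by
  have hJ : ExtVanishesBelow (maximalIdeal R) (LinearMap.range ψ) (d + 1) := by
    rw [hψ]
    exact (hR.mono (by omega)).left hA (f := (LinearMap.ker (Algebra.linearMap R A)).subtype)
      (g := Algebra.linearMap R A) Subtype.val_injective
      (LinearMap.exact_subtype_ker_map _) hsurj
  refine (hR.pi ι).left hJ (f := (LinearMap.ker ψ).subtype) (g := ψ.rangeRestrict)
    Subtype.val_injective ?_ ψ.surjective_rangeRestrict
  intro x
  simp [Subtype.ext_iff]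

end SurjectiveLocal

lemma linearCombination_algebraMap {S R : Type*} [CommRing S] [CommRing R] [Algebra S R]
    {ι : Type*} [Fintype ι] (g v : ι → S) :
    Fintype.linearCombination R (fun i => algebraMap S R (g i)) (fun i => algebraMap S R (v i)) =
      algebraMap S R (Fintype.linearCombination S g v) := by
  simp [Fintype.linearCombination_apply]

section Localization

variable {S : Type} [CommRing S] {m : Ideal S} [m.IsPrime] {R : Type} [CommRing R] [Algebra S R]
  [IsLocalization.AtPrime R m]

/-- If the syzygies become free after localization, then generators all of whose relations have
coefficients in `m` are linearly independent. -/
lemma linearIndependent_of_free_ker_localization [IsLocalRing R]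
    (hinj : Function.Injective (algebraMap S R)) {ι κ : Type} [Fintype ι] [Fintype κ] {g : ι → S}
    {k : κ → ι → S}
    (hk : Submodule.span S (Set.range k) = LinearMap.ker (Fintype.linearCombination S g))
    (hrel : ∀ c : κ → S, ∑ j, c j • k j = 0 → ∀ j, c j ∈ m)
    (hfree : Module.Free R
      (LinearMap.ker (Fintype.linearCombination R fun i => algebraMap S R (g i)))) :
    LinearIndependent S k := by
  have hunit : ∀ s : S, s ∉ m → IsUnit (algebraMap S R s) :=
    fun s hs => IsLocalization.map_units R (⟨s, hs⟩ : m.primeCompl)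
  let ψ : (ι → R) →ₗ[R] R := Fintype.linearCombination R fun i => algebraMap S R (g i)
  have hkker : ∀ j, (fun i => algebraMap S R (k j i)) ∈ LinearMap.ker ψ := by
    intro j
    have : k j ∈ LinearMap.ker (Fintype.linearCombination S g) :=
      hk ▸ Submodule.subset_span ⟨j, rfl⟩
    rw [LinearMap.mem_ker, linearCombination_algebraMap, LinearMap.mem_ker.mp this, map_zero]
  let k' : κ → LinearMap.ker ψ := fun j => ⟨_, hkker j⟩
  have hlc : ∀ c : κ → S, ∀ i,
      (∑ j, algebraMap S R (c j) • k' j : LinearMap.ker ψ).1 i =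
        algebraMap S R ((∑ j, c j • k j) i) := by
    intro c i
    simp [k', Finset.sum_apply, Algebra.smul_def]
  have hspan : Submodule.span R (Set.range k') = ⊤ := by
    rw [eq_top_iff]
    rintro ⟨v, hv⟩ -
    -- Clearing denominators turns a local syzygy into a global one, up to a unit of `R`; relations
    -- among the generators are treated in the same way below.
    obtain ⟨b, hb⟩ := IsLocalization.exist_integer_multiples_of_finite m.primeCompl v
    choose w hw using hb
    have hwker : w ∈ LinearMap.ker (Fintype.linearCombination S g) := by
      rw [LinearMap.mem_ker]
      apply hinj
      rw [← linearCombination_algebraMap, map_zero]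
      have : (fun i => algebraMap S R (w i)) = algebraMap S R (b : S) • v := by
        ext1 i
        rw [hw, Pi.smul_apply, Algebra.smul_def, smul_eq_mul]
      rw [this, map_smul, LinearMap.mem_ker.mp hv, smul_zero]
    rw [← hk, Submodule.mem_span_range_iff_exists_fun] at hwker
    obtain ⟨c, hc⟩ := hwker
    obtain ⟨u, hu⟩ := hunit b b.2
    have : (⟨v, hv⟩ : LinearMap.ker ψ) = (↑u⁻¹ : R) • ∑ j, algebraMap S R (c j) • k' j := by
      apply Subtype.ext
      ext1 i
      rw [Submodule.coe_smul, Pi.smul_apply, hlc, hc, hw, smul_eq_mul, Algebra.smul_def, ← hu,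
        Units.inv_mul_cancel_left]
    rw [this]
    exact Submodule.smul_mem _ _ (Submodule.sum_mem _ fun j _ =>
      Submodule.smul_mem _ _ (Submodule.subset_span ⟨j, rfl⟩))
  have hrel' : ∀ c : κ → R, ∑ j, c j • k' j = 0 → ∀ j, c j ∈ maximalIdeal R := by
    intro c hc j
    obtain ⟨b, hb⟩ := IsLocalization.exist_integer_multiples_of_finite m.primeCompl c
    choose e he using hb
    have hsum : ∑ j, e j • k j = 0 := by
      ext1 i
      apply hinj
      rw [← hlc, Pi.zero_apply, map_zero]
      have : ∑ j, algebraMap S R (e j) • k' j = algebraMap S R (b : S) • ∑ j, c j • k' j := by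
        rw [Finset.smul_sum]
        refine Finset.sum_congr rfl fun j _ => ?_
        rw [he, smul_smul, Algebra.smul_def]
      rw [this, hc, smul_zero]
      rfl
    have hem := hrel e hsum j
    have : algebraMap S R (b : S) * c j ∈ maximalIdeal R := by
      rw [← Algebra.smul_def, ← he]
      exact (IsLocalization.AtPrime.to_map_mem_maximal_iff R m (e j)).mpr hem
    exact (Ideal.unit_mul_mem_iff_mem _ (hunit b b.2)).mp this
  have hli := linearIndependent_of_relations k' hspan hrel'
  rw [Fintype.linearIndependent_iff] at hli ⊢
  intro c hc j
  apply hinj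
  rw [map_zero]
  refine hli (fun j => algebraMap S R (c j)) ?_ j
  apply Subtype.ext
  ext1 i
  rw [hlc, hc]
  simp

variable {I : Ideal S} {p : Ideal (S ⧸ I)} [p.IsPrime] {A : Type} [CommRing A]
  [Algebra (S ⧸ I) A] [IsLocalization.AtPrime A p] [Algebra R A]

/-- Here `R` is the localization of `S` at `m` and `A` that of `S ⧸ I` at the corresponding prime
`p`. Numerators and denominators lift separately. -/
lemma surjective_of_localization_quotient (hcomap : p.comap (Ideal.Quotient.mk I) = m)
    (hf : ∀ a : S, algebraMap R A (algebraMap S R a) = algebraMap _ A (Ideal.Quotient.mk I a)) :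
    Function.Surjective (algebraMap R A) := by
  intro x
  obtain ⟨a, s, rfl⟩ := IsLocalization.exists_mk'_eq p.primeCompl x
  obtain ⟨a, rfl⟩ := Ideal.Quotient.mk_surjective a
  obtain ⟨s, hs⟩ := s
  obtain ⟨s, rfl⟩ := Ideal.Quotient.mk_surjective s
  have hsm : s ∈ m.primeCompl := fun h => hs (by rw [← hcomap] at h; exact h)
  refine ⟨IsLocalization.mk' R a (⟨s, hsm⟩ : m.primeCompl), ?_⟩
  rw [IsLocalization.eq_mk'_iff_mul_eq]
  rw [← hf, ← hf, ← map_mul, IsLocalization.mk'_spec R a (⟨s, hsm⟩ : m.primeCompl)]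

/-- A fraction `a/s` vanishes in `A` only if `t * a ∈ I` for some `t ∉ m`, and `t` is a unit in `R`.
Hence the kernel of `R → A` is the extension of `I`. -/
lemma range_eq_ker_of_localization_quotient (hcomap : p.comap (Ideal.Quotient.mk I) = m)
    (hf : ∀ a : S, algebraMap R A (algebraMap S R a) = algebraMap _ A (Ideal.Quotient.mk I a))
    {ι : Type} [Fintype ι] {g : ι → S} (hg : Ideal.span (Set.range g) = I) :
    LinearMap.range (Fintype.linearCombination R fun i => algebraMap S R (g i)) =
      LinearMap.ker (Algebra.linearMap R A) := by
  rw [Fintype.range_linearCombination]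
  apply le_antisymm
  · rw [Submodule.span_le]
    rintro _ ⟨i, rfl⟩
    simp only [SetLike.mem_coe, LinearMap.mem_ker, Algebra.linearMap_apply]
    rw [hf, Ideal.Quotient.eq_zero_iff_mem.mpr (hg ▸ Ideal.subset_span ⟨i, rfl⟩), map_zero]
  · intro x hx
    obtain ⟨a, s, rfl⟩ := IsLocalization.exists_mk'_eq m.primeCompl x
    have ha : algebraMap R A (algebraMap S R a) = 0 := by
      rw [LinearMap.mem_ker, Algebra.linearMap_apply] at hx
      rw [← IsLocalization.mk'_spec R a s, map_mul, hx, zero_mul]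
    rw [hf, IsLocalization.map_eq_zero_iff p.primeCompl] at ha
    obtain ⟨⟨t, htp⟩, ht⟩ := ha
    obtain ⟨t, rfl⟩ := Ideal.Quotient.mk_surjective t
    have htm : t ∈ m.primeCompl := fun h => htp (by rw [← hcomap] at h; exact h)
    have hta : t * a ∈ I := by
      rw [← Ideal.Quotient.eq_zero_iff_mem, map_mul]; exact ht
    have hmap : algebraMap S R (t * a) ∈ Submodule.span R
        (Set.range fun i => algebraMap S R (g i)) := by
      have := Ideal.mem_map_of_mem (algebraMap S R) hta
      rw [← hg, Ideal.map_span, ← Set.range_comp] at this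
      exact this
    have : IsLocalization.mk' R a s =
        IsLocalization.mk' R 1 (s * ⟨t, htm⟩ : m.primeCompl) • algebraMap S R (t * a) := by
      rw [smul_eq_mul, mul_comm, IsLocalization.mul_mk'_eq_mk'_of_mul, mul_one,
        IsLocalization.mk'_eq_iff_eq]
      congr 1
      simp only [Submonoid.coe_mul]
      ring
    rw [this]
    exact Submodule.smul_mem _ _ hmap

/-- Depth `d` of `A` gives the local syzygies depth `d + 2`, the number of given generators of the
maximal ideal, so they are free. -/
lemma linearIndependent_of_isRegular_localization [IsLocalRing R] [IsNoetherianRing R]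
    [IsLocalRing A] (hcomap : p.comap (Ideal.Quotient.mk I) = m)
    (hf : ∀ a : S, algebraMap R A (algebraMap S R a) = algebraMap _ A (Ideal.Quotient.mk I a))
    (hinj : Function.Injective (algebraMap S R)) {d : ℕ}
    (hR : ExtVanishesBelow (maximalIdeal R) R (d + 2)) {y : Fin (d + 2) → R}
    (hy : Ideal.span (Set.range y) = maximalIdeal R) {rs : List A} (hrs : IsRegular A rs)
    (hd : d ≤ rs.length) {ι κ : Type} [Fintype ι] [Fintype κ] {g : ι → S}
    (hg : Ideal.span (Set.range g) = I) {k : κ → ι → S}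
    (hk : Submodule.span S (Set.range k) = LinearMap.ker (Fintype.linearCombination S g))
    (hrel : ∀ c : κ → S, ∑ j, c j • k j = 0 → ∀ j, c j ∈ m) : LinearIndependent S k := by
  have hsurj : Function.Surjective (algebraMap R A) :=
    surjective_of_localization_quotient (m := m) hcomap hf
  have hA := (extVanishesBelow_of_surjective hsurj rs hrs).mono hd
  have hL := extVanishesBelow_ker_of_surjective hsurj hR hA _
    (range_eq_ker_of_localization_quotient (m := m) hcomap hf hg)
  exact linearIndependent_of_free_ker_localization hinj hk hrel
    (free_of_extVanishesBelow (d + 2) R y hy _ hL)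

end Localization

/-- Over the coordinate ring, the minimal generators of the syzygies of an ideal of codimension
two with Cohen-Macaulay quotient are linearly independent. -/
theorem linearIndependent_syzygies {n : ℕ} (hn : 1 ≤ n) {ι κ : Type} [Fintype ι] [Fintype κ]
    {I : Ideal (CoordRing n)} (hI : I ≤ irrelevantIdeal n)
    (hdim : ((n - 1 : ℕ) : ℕ∞) ≤ ((irrelevantIdeal n).map (Ideal.Quotient.mk I)).height)
    (hCM : IsCohenMacaulayRing (CoordRing n ⧸ I))
    {g : ι → CoordRing n} (hg : Ideal.span (Set.range g) = I)
    {k : κ → ι → CoordRing n}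
    (hk : Submodule.span (CoordRing n) (Set.range k) =
      LinearMap.ker (Fintype.linearCombination (CoordRing n) g))
    (hrel : ∀ c : κ → CoordRing n, ∑ j, c j • k j = 0 → ∀ j, c j ∈ irrelevantIdeal n) :
    LinearIndependent (CoordRing n) k := by
  let m := irrelevantIdeal n
  have hpmax : (m.map (Ideal.Quotient.mk I)).IsMaximal := by
    refine Ideal.IsMaximal.map_of_surjective_of_ker_le Ideal.Quotient.mk_surjective ?_
    simpa using hI
  let p := m.map (Ideal.Quotient.mk I)
  have hcomap : p.comap (Ideal.Quotient.mk I) = m := by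
    rw [Ideal.comap_map_of_surjective _ Ideal.Quotient.mk_surjective]
    simpa [← RingHom.ker_eq_comap_bot] using hI
  obtain ⟨rs, hreg, hlen⟩ := hCM p
  rw [IsLocalization.AtPrime.ringKrullDim_eq_height p] at hlen
  have hlen' : n - 1 ≤ rs.length := by
    have : ((rs.length : ℕ) : ℕ∞) = p.height := by exact_mod_cast hlen
    rw [← this] at hdim
    exact_mod_cast hdim
  -- With `d = n - 1`, the value `d + 2` is the depth `n + 1` of the localized coordinate ring.
  obtain ⟨d, rfl⟩ : ∃ d, n = d + 1 := ⟨n - 1, by omega⟩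
  obtain ⟨y, hy⟩ := exists_span_range_eq_maximalIdeal_localization (d + 1)
  let f := Localization.localRingHom m p (Ideal.Quotient.mk I) hcomap.symm
  let _ : Algebra (Localization.AtPrime m) (Localization.AtPrime p) := f.toAlgebra
  exact linearIndependent_of_isRegular_localization (m := m) (R := Localization.AtPrime m)
    (A := Localization.AtPrime p) hcomap
    (fun a => Localization.localRingHom_to_map _ _ _ _ a)
    (IsLocalization.injective _ m.primeCompl_le_nonZeroDivisors)
    (extVanishesBelow_localization (d + 1)) hy hreg hlen' hg hk hrel

end Syzygies
end ACMHypersurface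

namespace ACMHypersurface
-- The Hilbert–Burch theorem.
section HilbertBurch
open scoped Matrix

variable {S : Type} [CommRing S] {κ : Type} [Fintype κ] [DecidableEq κ]

/-- The determinant of the square matrix obtained from `M` by adding the column `v`, as a linear
function of `v`. -/
noncomputable def lastColumnDet (M : Matrix (κ ⊕ Unit) κ S) : (κ ⊕ Unit → S) →ₗ[S] S where
  toFun v := (Matrix.fromCols M (Matrix.replicateCol Unit v)).det
  map_add' v w := by
    have h : ∀ v, Matrix.fromCols M (Matrix.replicateCol Unit v) =
        (Matrix.fromCols M (0 : Matrix _ Unit S)).updateCol (Sum.inr ()) v := by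
      intro v
      ext i (j | j) <;> simp
    rw [h, h, h, Matrix.det_updateCol_add]
  map_smul' a v := by
    have h : ∀ v, Matrix.fromCols M (Matrix.replicateCol Unit v) =
        (Matrix.fromCols M (0 : Matrix _ Unit S)).updateCol (Sum.inr ()) v := by
      intro v
      ext i (j | j) <;> simp
    rw [h, h, Matrix.det_updateCol_smul]
    rfl

lemma lastColumnDet_apply (M : Matrix (κ ⊕ Unit) κ S) (v : κ ⊕ Unit → S) :
    lastColumnDet M v = (Matrix.fromCols M (Matrix.replicateCol Unit v)).det := rfl

lemma lastColumnDet_mulVec (M : Matrix (κ ⊕ Unit) κ S) (w : κ → S) :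
    lastColumnDet M (M *ᵥ w) = 0 := by
  have h : M *ᵥ w = ∑ j, w j • (fun i => M i j) := by
    ext i
    simp [Matrix.mulVec, dotProduct, Finset.sum_apply, mul_comm]
  rw [h, map_sum]
  refine Finset.sum_eq_zero fun j _ => ?_
  rw [map_smul, lastColumnDet_apply,
    Matrix.det_zero_of_column_eq (i := Sum.inl j) (j := Sum.inr ()) (by simp) (by simp), smul_zero]

/-- If all maximal minors vanish, a nonzero multiple of every basis vector lies in the image of the
injective `M`. The preimages are then one more independent vector than `κ → S` can hold. -/
lemma exists_lastColumnDet_ne_zero [IsDomain S] {M : Matrix (κ ⊕ Unit) κ S}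
    (hM : ∀ w, M *ᵥ w = 0 → w = 0) : ∃ i, lastColumnDet M (Pi.single i 1) ≠ 0 := by
  by_contra! h
  have hex : ∀ i, ∃ (w : κ → S) (c : S), c ≠ 0 ∧ M *ᵥ w = c • Pi.single i 1 := by
    intro i
    obtain ⟨v, hv0, hv⟩ := Matrix.exists_mulVec_eq_zero_iff.mpr (h i)
    have hv' : M *ᵥ (v ∘ Sum.inl) + v (Sum.inr ()) • Pi.single i 1 = 0 := by
      rw [Matrix.fromCols_mulVec] at hv
      rw [← hv]
      congr 1
      ext x
      simp [Matrix.mulVec, dotProduct, mul_comm]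
    refine ⟨v ∘ Sum.inl, -v (Sum.inr ()), ?_, ?_⟩
    · intro hc
      rw [neg_eq_zero] at hc
      rw [hc, zero_smul, add_zero] at hv'
      refine hv0 (funext ?_)
      rintro (j | j)
      · exact congrFun (hM _ hv') j
      · exact hc
    · rw [neg_smul]
      exact eq_neg_of_add_eq_zero_left hv'
  choose w c hc hw using hex
  have hli : LinearIndependent S w := by
    rw [Fintype.linearIndependent_iff]
    intro a ha i
    have h1 : ∑ i, a i • (c i • (Pi.single i 1 : κ ⊕ Unit → S)) = 0 := by
      simp_rw [← hw, ← Matrix.mulVec_smul, ← Matrix.mulVec_sum]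
      rw [ha, Matrix.mulVec_zero]
    have h2 := congrFun h1 i
    rw [Finset.sum_apply, Finset.sum_eq_single i] at h2
    · simpa [hc i] using h2
    · intro j _ hj
      simp [hj.symm]
    · simp
  have := hli.fintype_card_le_finrank
  simp at this

omit [DecidableEq κ] in
-- The cokernel of `M` embeds in `S` and so is torsion-free: if `M w = q z`, then `z = M w'` for
-- some `w'`, and injectivity gives `w = q w'`.
lemma mulVec_map_quotient_injective [IsDomain S] {M : Matrix (κ ⊕ Unit) κ S} {g : κ ⊕ Unit → S}
    (hinj : Function.Injective M.mulVecLin)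
    (hex : Function.Exact M.mulVecLin (Fintype.linearCombination S g)) {q : S} (hq : q ≠ 0)
    (w : κ → S ⧸ Ideal.span {q})
    (hw : (M.map (Ideal.Quotient.mk (Ideal.span {q}))) *ᵥ w = 0) : w = 0 := by
  obtain ⟨w, rfl⟩ : ∃ w' : κ → S, w = fun i => Ideal.Quotient.mk _ (w' i) := by
    choose w' hw' using fun i => Ideal.Quotient.mk_surjective (w i)
    exact ⟨w', funext fun i => (hw' i).symm⟩
  have hdvd : ∀ i, ∃ z, (M *ᵥ w) i = q * z := by
    intro i
    have h2 : Ideal.Quotient.mk (Ideal.span {q}) ((M *ᵥ w) i) = 0 := by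
      rw [RingHom.map_mulVec]
      exact congrFun hw i
    exact Ideal.mem_span_singleton.mp (Ideal.Quotient.eq_zero_iff_mem.mp h2)
  choose z hz using hdvd
  have hMw : M.mulVecLin w = q • z := funext hz
  have hgz : Fintype.linearCombination S g z = 0 := by
    have : Fintype.linearCombination S g (q • z) = 0 := (hex _).mpr ⟨w, hMw⟩
    rw [map_smul, smul_eq_mul] at this
    exact (mul_eq_zero.mp this).resolve_left hq
  obtain ⟨w', hw'⟩ := (hex z).mp hgz
  have : w = q • w' := hinj (by rw [hMw, map_smul, hw'])
  ext i
  rw [this]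
  exact Ideal.Quotient.eq_zero_iff_mem.mpr (Ideal.mem_span_singleton.mpr ⟨w' i, rfl⟩)

/-- The Hilbert-Burch theorem for ideals of height at least two. -/
theorem exists_isUnit_lastColumnDet_eq [IsDomain S] [IsNoetherianRing S]
    [UniqueFactorizationMonoid S] {M : Matrix (κ ⊕ Unit) κ S} {g : κ ⊕ Unit → S}
    (hinj : Function.Injective M.mulVecLin)
    (hex : Function.Exact M.mulVecLin (Fintype.linearCombination S g))
    (hheight : 2 ≤ (Ideal.span (Set.range g)).height) :
    ∃ u : S, IsUnit u ∧ ∀ v, lastColumnDet M v = u * Fintype.linearCombination S g v := by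
  -- Both linear forms vanish on the image of `M`, which is the whole kernel of the second one;
  -- hence they are proportional.
  have key : ∀ v w, Fintype.linearCombination S g v * lastColumnDet M w =
      Fintype.linearCombination S g w * lastColumnDet M v := by
    intro v w
    have hker : Fintype.linearCombination S g
        (Fintype.linearCombination S g v • w - Fintype.linearCombination S g w • v) = 0 := by
      simp only [map_sub, map_smul, smul_eq_mul]
      ring
    obtain ⟨x, hx⟩ := (hex _).mp hker
    have := lastColumnDet_mulVec M x
    rw [← Matrix.mulVecLin_apply, hx] at this
    simp only [map_sub, map_smul, smul_eq_mul] at this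
    linear_combination this
  have hsingle : ∀ i, Fintype.linearCombination S g (Pi.single i 1) = g i := fun i => by
    simp [Fintype.linearCombination_apply_single]
  obtain ⟨i₀, hi₀⟩ : ∃ i, g i ≠ 0 := by
    by_contra! h
    refine not_le_span_singleton_of_two_le_height hheight not_isUnit_zero (Ideal.span_le.mpr ?_)
    rintro _ ⟨i, rfl⟩
    simp [h i]
  obtain ⟨a, b, c, hab, hca, hcb⟩ := UniqueFactorizationMonoid.exists_reduced_factors (g i₀) hi₀
    (lastColumnDet M (Pi.single i₀ 1))
  have hc : c ≠ 0 := by rintro rfl; exact hi₀ (by rw [← hca, zero_mul])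
  have hrel : ∀ w, a * lastColumnDet M w = b * Fintype.linearCombination S g w := by
    intro w
    have := key (Pi.single i₀ 1) w
    rw [hsingle, ← hca, ← hcb] at this
    refine mul_left_cancel₀ hc ?_
    linear_combination this
  -- A non-unit `a` would divide every generator, which height two forbids.
  have ha : IsUnit a := by
    by_contra ha
    refine not_le_span_singleton_of_two_le_height hheight ha (Ideal.span_le.mpr ?_)
    rintro _ ⟨i, rfl⟩
    rw [SetLike.mem_coe, Ideal.mem_span_singleton]
    exact hab.dvd_of_dvd_mul_left ⟨_, by rw [← hsingle i, ← hrel]⟩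
  obtain ⟨a', ha'⟩ := ha.exists_left_inv
  have hD : ∀ w, lastColumnDet M w = a' * b * Fintype.linearCombination S g w := by
    intro w
    linear_combination a' * hrel w - lastColumnDet M w * ha'
  refine ⟨a' * b, ?_, hD⟩
  -- An irreducible factor `q` of the multiplier would make all maximal minors vanish modulo `q`,
  -- although `M` stays injective over the domain `S/(q)`.
  by_contra hu
  have hne : a' * b ≠ 0 := by
    intro h0
    obtain ⟨i, hi⟩ := exists_lastColumnDet_ne_zero (M := M) fun w hw =>
      hinj (by simpa using hw)
    exact hi (by rw [hD, h0, zero_mul])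
  obtain ⟨q, hq, hqdvd⟩ := WfDvdMonoid.exists_irreducible_factor hu hne
  have hprime : (Ideal.span {q}).IsPrime :=
    (Ideal.span_singleton_prime hq.ne_zero).mpr hq.prime
  obtain ⟨i, hi⟩ := exists_lastColumnDet_ne_zero
    (mulVec_map_quotient_injective hinj hex hq.ne_zero)
  refine hi ?_
  have hmap : lastColumnDet (M.map (Ideal.Quotient.mk (Ideal.span {q}))) (Pi.single i 1) =
      Ideal.Quotient.mk (Ideal.span {q}) (lastColumnDet M (Pi.single i 1)) := by
    rw [lastColumnDet_apply, lastColumnDet_apply, RingHom.map_det]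
    congr 1
    ext x (j | j)
    · simp
    · simp [Pi.single_apply, apply_ite (Ideal.Quotient.mk (Ideal.span {q}))]
  rw [hmap, hD, Ideal.Quotient.eq_zero_iff_mem, Ideal.mem_span_singleton]
  exact hqdvd.mul_right _

omit [DecidableEq κ] in
/-- The ranks in a free resolution of length one of a nonzero ideal. -/
lemma card_eq_of_resolution [IsDomain S] [IsNoetherianRing S] {ι : Type} [Fintype ι]
    {M : Matrix ι κ S} {g : ι → S} (hinj : Function.Injective M.mulVecLin)
    (hex : Function.Exact M.mulVecLin (Fintype.linearCombination S g))
    (hne : Ideal.span (Set.range g) ≠ ⊥) : Fintype.card ι = Fintype.card κ + 1 := by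
  have h := Submodule.finrank_quotient_add_finrank
    (LinearMap.ker (Fintype.linearCombination S g))
  rw [(Fintype.linearCombination S g).quotKerEquivRange.finrank_eq, hex.linearMap_ker_eq,
    LinearMap.finrank_range_of_inj hinj,
    Module.finrank_fintype_fun_eq_card,
    Module.finrank_fintype_fun_eq_card, Fintype.range_linearCombination] at h
  have h1 : Module.finrank S (Submodule.span S (Set.range g)) = 1 := by
    apply le_antisymm
    · simpa using Submodule.finrank_le (Submodule.span S (Set.range g))
    · have : Nontrivial (Submodule.span S (Set.range g)) :=
        Submodule.nontrivial_iff_ne_bot.mpr hne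
      exact Module.finrank_pos
  omega

end HilbertBurch
end ACMHypersurface

namespace ACMHypersurface
-- From a matrix of forms to a weak admissible pair.
section Determinantal
open scoped Matrix

variable {n : ℕ}

/-- Pigeonhole: no permutation sends the `i + 1` columns up to `i` into the `i` rows above row `i`,
so every term of the Leibniz expansion meets the zero block. -/
lemma det_eq_zero_of_zero_block {R : Type*} [CommRing R] {t : ℕ} {N : Matrix (Fin t) (Fin t) R}
    {i : Fin t} (h : ∀ k l, i ≤ k → l ≤ i → N k l = 0) : N.det = 0 := by
  rw [Matrix.det_apply]
  refine Finset.sum_eq_zero fun σ _ => ?_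
  obtain ⟨l, hl, hσ⟩ : ∃ l ≤ i, i ≤ σ l := by
    by_contra! hcon
    have hsub : (Finset.Iic i).image σ ⊆ Finset.Iio i := by
      intro x hx
      obtain ⟨l, hl, rfl⟩ := Finset.mem_image.mp hx
      exact Finset.mem_Iio.mpr (hcon l (Finset.mem_Iic.mp hl))
    have := Finset.card_le_card hsub
    rw [Finset.card_image_of_injective _ σ.injective, Fin.card_Iic, Fin.card_Iio] at this
    omega
  have h0 : ∏ x, N (σ x) x = 0 := Finset.prod_eq_zero (Finset.mem_univ l) (h _ _ hσ hl)
  rw [h0, smul_zero]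

lemma exists_equiv_monotone {ι : Type} [Fintype ι] {t : ℕ} (e : Fin t ≃ ι) (a : ι → ℤ) :
    ∃ σ : Fin t ≃ ι, Monotone (a ∘ σ) :=
  ⟨(Tuple.sort (a ∘ e)).trans e, Tuple.monotone_sort (a ∘ e)⟩

/-- A square matrix of forms without nonzero constant entries, whose determinant defines the
hypersurface, has the type obtained by sorting its degrees. -/
lemma exists_isWeakDeterminantalOfType {F : CoordRing n} (hF0 : F ≠ 0) {ι : Type} [Fintype ι]
    [DecidableEq ι] (hcard : 2 ≤ Fintype.card ι) {a b : ι → ℤ} {N : Matrix ι ι (CoordRing n)}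
    (hN : ∀ i j, IsHomogeneousOfDegree (N i j) (b j - a i))
    (hNm : ∀ i j, N i j ∈ irrelevantIdeal n) {u : CoordRing n} (hu : IsUnit u)
    (hdet : N.det = u * F) :
    ∃ (P : WeakAdmissiblePair) (σ τ : Fin P.t ≃ ι), P.a = a ∘ σ ∧ P.b = b ∘ τ ∧
      IsWeakDeterminantalOfType F P := by
  obtain ⟨σ, hσ⟩ := exists_equiv_monotone (Fintype.equivFin ι).symm a
  obtain ⟨τ, hτ⟩ := exists_equiv_monotone (Fintype.equivFin ι).symm b
  have hzero : ∀ i j, b (τ j) ≤ a (σ i) → N (σ i) (τ j) = 0 := fun i j h =>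
    (hN _ _).eq_zero_of_nonpos (by omega) (hNm _ _)
  have hNdet : (N.submatrix σ τ).det ≠ 0 := by
    have h1 : N.submatrix σ τ = (N.submatrix σ σ).submatrix id (τ.trans σ.symm) := by
      ext i j; simp
    rw [h1, Matrix.det_permute', Matrix.det_submatrix_equiv_self, hdet]
    exact mul_ne_zero ((Units.isUnit _).map (Int.castRingHom (CoordRing n))).ne_zero
      (mul_ne_zero hu.ne_zero hF0)
  obtain ⟨w, hw, hwdet⟩ : ∃ w : CoordRing n, IsUnit w ∧ F = w * (N.submatrix σ τ).det := by
    have h1 : N.submatrix σ τ = (N.submatrix σ σ).submatrix id (τ.trans σ.symm) := by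
      ext i j; simp
    rw [h1, Matrix.det_permute', Matrix.det_submatrix_equiv_self, hdet]
    have hs : IsUnit (((Equiv.Perm.sign (τ.trans σ.symm) : ℤˣ) : ℤ) : CoordRing n) :=
      (Units.isUnit _).map (Int.castRingHom (CoordRing n))
    obtain ⟨w, hw⟩ := hs.mul hu
    refine ⟨↑w⁻¹, Units.isUnit _, ?_⟩
    rw [← mul_assoc _ u, ← hw, Units.inv_mul_cancel_left]
  obtain ⟨c, hc, rfl⟩ := MvPolynomial.isUnit_iff_eq_C_of_isReduced.mp hw
  let P : WeakAdmissiblePair :=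
    { t := Fintype.card ι
      two_le := hcard
      a := a ∘ σ
      b := b ∘ τ
      a_mono := hσ
      b_mono := hτ
      -- If `bᵢ ≤ aᵢ` in the sorted order, monotonicity produces a zero block at `i`, contradicting
      -- the nonzero determinant.
      a_lt_b := by
        intro i
        by_contra! hle
        refine hNdet (det_eq_zero_of_zero_block (i := i) fun k l hik hli => ?_)
        exact hzero k l ((hτ hli).trans (hle.trans (hσ hik))) }
  let i₀ : Fin (Fintype.card ι) := ⟨0, by omega⟩
  -- The unit and the sign from sorting combine to a constant, which is absorbed into one column
  -- without changing degrees.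
  refine ⟨P, σ, τ, rfl, rfl, (N.submatrix σ τ).updateCol i₀
    ((C c : CoordRing n) • fun i => N.submatrix σ τ i i₀), ?_, ?_, ?_⟩
  · intro i j
    rw [Matrix.updateCol_apply]
    split_ifs with hj
    · subst hj
      have h0 : IsHomogeneousOfDegree (C c : CoordRing n) 0 := by
        simpa using isHomogeneousOfDegree_monomial (n := n) 0 c
      have := h0.mul (hN (σ i) (τ i₀))
      rwa [zero_add] at this
    · exact hN _ _
  · intro i j hij
    have := hzero i j hij
    rw [Matrix.updateCol_apply]
    split_ifs with hj
    · subst hj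
      simp [this]
    · exact this
  · rw [Matrix.det_updateCol_smul, Matrix.updateCol_eq_self, hwdet]

end Determinantal

/-! ### Height two, and the resolutions of ACM subschemes of `X`. -/

section Main
open scoped Matrix
attribute [local instance] MvPolynomial.gradedAlgebra

variable {n : ℕ}

lemma HasExactlyTypes.exists_equiv {F : CoordRing n} {I : Type*} {T : I → WeakAdmissiblePair}
    (hT : HasExactlyTypes F T) (hF0 : F ≠ 0) {ι : Type} [Fintype ι]
    [DecidableEq ι] (hcard : 2 ≤ Fintype.card ι) {a b : ι → ℤ} {N : Matrix ι ι (CoordRing n)}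
    (hN : ∀ i j, IsHomogeneousOfDegree (N i j) (b j - a i))
    (hNm : ∀ i j, N i j ∈ irrelevantIdeal n) {u : CoordRing n} (hu : IsUnit u)
    (hdet : N.det = u * F) :
    IsWeakDeterminantal F ∧ ∃ (j : I) (k : ℤ) (σ τ : Fin (T j).t ≃ ι),
      (∀ i, a (σ i) = (T j).a i + k) ∧ ∀ i, b (τ i) = (T j).b i + k := by
  obtain ⟨P, σ, τ, ha, hb, hP⟩ := exists_isWeakDeterminantalOfType hF0 hcard hN hNm hu hdet
  obtain ⟨j, h, k, hk⟩ := (hT P).mp hP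
  refine ⟨⟨P, hP⟩, j, k, (finCongr h).trans σ, (finCongr h).trans τ, fun i => ?_, fun i => ?_⟩
  · rw [← (hk i).1, ha]; rfl
  · rw [← (hk i).2, hb]; rfl

namespace ClosedSubscheme

variable {Y : ClosedSubscheme n} {F : CoordRing n}

/-- Every minimal prime of the ideal has height at least one above `(F)`, which itself has height at
least one. Conversely, a prime of height one in `S/(F)` over the ideal pulls back to height at most
two. -/
lemma HasCodimOneIn.height_and_exists (hF0 : F ≠ 0) (hYX : Y.IsContainedIn F)
    (h : Y.HasCodimOneIn F) :
    Y.ideal.toIdeal.height = 2 ∧ Y.ideal.toIdeal ≠ ⊤ ∧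
      ∃ Q : Ideal (CoordRing n), Q.IsPrime ∧ Y.ideal.toIdeal ≤ Q ∧ Q ≤ irrelevantIdeal n ∧
        Q.height = 2 := by
  set I := Y.ideal.toIdeal with hI
  have hFI : F ∈ I := hYX
  have hone : 1 ≤ (Ideal.span {F}).height :=
    Ideal.one_le_height_span_singleton_of_mem_nonZeroDivisors (mem_nonZeroDivisors_of_ne_zero hF0)
  have hlower : 2 ≤ I.height := by
    rw [Ideal.height_eq_inf_minimalPrimes]
    refine le_iInf₂ fun P hP => ?_
    have := hP.isPrime
    have hFP : Ideal.span {F} ≤ P := (Ideal.span_singleton_le_iff_mem _).mpr (hP.1.2 hFI)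
    have h1 : ((1 : ℕ) : ℕ∞) ≤ (P.map (Ideal.Quotient.mk (Ideal.span {F}))).height := by
      rw [Nat.cast_one, ← h]
      exact Ideal.height_mono (Ideal.map_mono hP.1.2)
    refine le_trans ?_ (height_add_le_height_of_le_height_map 1 P hFP h1)
    calc (2 : ℕ∞) = 1 + 1 := by norm_num
      _ ≤ _ := by simpa using add_le_add_left hone 1
  obtain ⟨p, hp, hIp, hp1⟩ := Ideal.exists_isPrime_height_eq (n := 1) (by exact_mod_cast h)
  have hmap : (p.comap (Ideal.Quotient.mk (Ideal.span {F}))).map (Ideal.Quotient.mk _) = p :=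
    Ideal.map_comap_of_surjective _ Ideal.Quotient.mk_surjective p
  set Q := p.comap (Ideal.Quotient.mk (Ideal.span {F})) with hQ
  have hIQ : I ≤ Q := Ideal.map_le_iff_le_comap.mp hIp
  have hQle : Q.height ≤ 2 := by
    have := Ideal.height_le_height_add_one_of_mem (hIQ hFI)
    rw [hmap, hp1] at this
    exact this.trans (by norm_num)
  have hIne : I ≠ ⊤ := fun htop => (inferInstance : Q.IsPrime).ne_top (top_le_iff.mp (htop ▸ hIQ))
  -- Passing to the homogeneous core of `Q` keeps it prime and over the ideal of `Y`, and places it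
  -- inside the irrelevant ideal, where the local dimension is needed.
  refine ⟨le_antisymm ((Ideal.height_mono hIQ).trans hQle) hlower, hIne,
    (Q.homogeneousCore (homogeneousSubmodule (Fin (n + 1)) ℂ)).toIdeal, ?_, ?_, ?_, ?_⟩
  · exact Ideal.IsPrime.homogeneousCore inferInstance
  · have := Ideal.homogeneousCore_mono (homogeneousSubmodule (Fin (n + 1)) ℂ) hIQ
    rw [hI, HomogeneousIdeal.toIdeal_homogeneousCore_eq_self] at this
    exact this
  · refine (isGradedIdeal_toIdeal _).le_irrelevantIdeal fun htop => ?_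
    have := Ideal.toIdeal_homogeneousCore_le (homogeneousSubmodule (Fin (n + 1)) ℂ) Q
    rw [htop] at this
    exact (inferInstance : Q.IsPrime).ne_top (top_le_iff.mp this)
  · refine le_antisymm ((Ideal.height_mono (Ideal.toIdeal_homogeneousCore_le _ Q)).trans hQle) ?_
    refine hlower.trans (Ideal.height_mono ?_)
    have := Ideal.homogeneousCore_mono (homogeneousSubmodule (Fin (n + 1)) ℂ) hIQ
    rw [hI, HomogeneousIdeal.toIdeal_homogeneousCore_eq_self] at this
    exact this

lemma IsCompleteIntersection.isACM (hheight : Y.ideal.toIdeal.height = 2)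
    (h : Y.IsCompleteIntersection) : Y.IsACM := by
  obtain ⟨r, hr, f, -, hf⟩ := h
  obtain rfl : r = 2 := by
    rw [hheight] at hr
    exact_mod_cast hr.symm
  obtain ⟨hinj, hex⟩ := koszulMap_injective_and_exact f (by rw [hf, hheight])
  exact isCohenMacaulayRing_of_resolution hinj hex _
    (by rw [Fintype.range_linearCombination]; exact hf) hheight.ge

lemma HasMinimalFreeResolution.isACM (hheight : Y.ideal.toIdeal.height = 2) {ι κ : Type}
    [Fintype ι] [Fintype κ] {α : ι → ℤ} {β : κ → ℤ} (h : Y.HasMinimalFreeResolution α β) :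
    Y.IsACM := by
  obtain ⟨g, M, -, -, -, hinj, hex, hrange⟩ := h
  exact isCohenMacaulayRing_of_resolution hinj hex _ hrange hheight.ge

/-- A minimal family of generators of the ideal of `Y` together with a matrix of its minimal
syzygies, which form a basis of all syzygies. -/
structure IsResolution (Y : ClosedSubscheme n) {ι κ : Type} [Fintype ι] [Fintype κ] (α : ι → ℤ)
    (β : κ → ℤ) (g : ι → CoordRing n) (M : Matrix ι κ (CoordRing n)) : Prop where
  minimal : IsMinimalFamily Y.ideal.toIdeal α g
  homogeneous : ∀ i j, IsHomogeneousOfDegree (M i j) (β j - α i)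
  mem : ∀ i j, M i j ∈ irrelevantIdeal n
  injective : Function.Injective M.mulVecLin
  exact : Function.Exact M.mulVecLin (Fintype.linearCombination (CoordRing n) g)

lemma IsResolution.reindex {ι κ ι' κ' : Type} [Fintype ι] [Fintype κ] [Fintype ι'] [Fintype κ']
    {α : ι → ℤ} {β : κ → ℤ} {g : ι → CoordRing n} {M : Matrix ι κ (CoordRing n)}
    (h : Y.IsResolution α β g M) (e₁ : ι' ≃ ι) (e₂ : κ' ≃ κ) :
    Y.IsResolution (α ∘ e₁) (β ∘ e₂) (g ∘ e₁) (M.submatrix e₁ e₂) := by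
  have hlc : ∀ v : ι' → CoordRing n, Fintype.linearCombination (CoordRing n) (g ∘ e₁) v =
      Fintype.linearCombination (CoordRing n) g (v ∘ e₁.symm) := by
    intro v
    simp only [Fintype.linearCombination_apply]
    exact Fintype.sum_equiv e₁ _ _ fun i => by simp
  have hmul : ∀ v : κ' → CoordRing n, (M.submatrix e₁ e₂).mulVecLin v =
      M.mulVecLin (v ∘ e₂.symm) ∘ e₁ := fun v => Matrix.submatrix_mulVec_equiv M v e₁ e₂
  refine ⟨⟨fun i => h.minimal.homogeneous _, ?_, ?_⟩, fun i j => h.homogeneous _ _,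
    fun i j => h.mem _ _, ?_, ?_⟩
  · rw [e₁.surjective.range_comp, h.minimal.span_eq]
  · intro c hc i
    have := h.minimal.relations (c ∘ e₁.symm) (by
      rw [← hc]
      exact Fintype.sum_equiv e₁.symm _ _ fun i => by simp) (e₁ i)
    simpa using this
  · intro v w hvw
    rw [hmul, hmul] at hvw
    have := h.injective (e₁.surjective.injective_comp_right hvw)
    exact e₂.symm.surjective.injective_comp_right this
  · intro v
    rw [hlc, h.exact (v ∘ e₁.symm)]
    constructor
    · rintro ⟨w, hw⟩
      refine ⟨w ∘ e₂, ?_⟩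
      rw [hmul]
      have : (w ∘ e₂) ∘ e₂.symm = w := by ext1 i; simp
      rw [this, hw]
      ext1 i; simp
    · rintro ⟨w, rfl⟩
      refine ⟨w ∘ e₂.symm, ?_⟩
      rw [hmul]
      ext1 i; simp

lemma IsResolution.hasMinimalFreeResolution {ι κ : Type} [Fintype ι] [Fintype κ]
    {α α' : ι → ℤ} {β β' : κ → ℤ} {g : ι → CoordRing n} {M : Matrix ι κ (CoordRing n)}
    (h : Y.IsResolution α β g M) (hα : α = α') (hβ : β = β') :
    Y.HasMinimalFreeResolution α' β' := by
  subst hα hβ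
  refine ⟨g, M, h.minimal.homogeneous, h.homogeneous, h.mem, h.injective, h.exact, ?_⟩
  rw [Fintype.range_linearCombination]
  exact h.minimal.span_eq

/-- The minimal free resolution of an arithmetically Cohen-Macaulay subscheme of codimension two. -/
lemma IsACM.exists_isResolution (h : Y.IsACM) (hheight : Y.ideal.toIdeal.height = 2)
    {Q : Ideal (CoordRing n)} (hQprime : Q.IsPrime) (hIQ : Y.ideal.toIdeal ≤ Q)
    (hQm : Q ≤ irrelevantIdeal n) (hQ : Q.height = 2) {ι : Type} [Fintype ι] {α : ι → ℤ}
    {g : ι → CoordRing n} (hg : IsMinimalFamily Y.ideal.toIdeal α g) :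
    ∃ (r : ℕ) (β : Fin r → ℤ) (M : Matrix ι (Fin r) (CoordRing n)),
      Y.IsResolution α β g M ∧ Fintype.card ι = r + 1 := by
  have hn : 1 ≤ n := by
    have h := Ideal.height_le_ringKrullDim_of_isPrime (I := Q)
    rw [ringKrullDim_coordRing, hQ] at h
    have : (2 : ℕ) ≤ n + 1 := by exact_mod_cast h
    omega
  obtain ⟨r, β, k, hhom, hspan, hrel⟩ := exists_minimal_generators α
    (LinearMap.ker (Fintype.linearCombination (CoordRing n) g)) (by
      intro v hv e
      rw [LinearMap.mem_ker, Fintype.linearCombination_apply] at hv ⊢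
      have := congrArg (hcomp e) hv
      rw [map_zero, map_sum] at this
      rw [← this]
      exact Finset.sum_congr rfl fun i _ => (hcomp_mul (hg.homogeneous i) e (v i)).symm)
  have hli := linearIndependent_syzygies hn (hIQ.trans hQm)
    (le_height_map_of_height_eq_two hIQ hQm hQ) h hg.span_eq hspan hrel
  let M : Matrix ι (Fin r) (CoordRing n) := Matrix.of fun i j => k j i
  have hM : ∀ c, M.mulVecLin c = Fintype.linearCombination (CoordRing n) k c := by
    intro c
    ext1 i
    simp [M, Matrix.mulVec, dotProduct, Fintype.linearCombination_apply, mul_comm]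
  have hker : ∀ j, k j ∈ LinearMap.ker (Fintype.linearCombination (CoordRing n) g) :=
    fun j => hspan ▸ Submodule.subset_span ⟨j, rfl⟩
  have hres : Y.IsResolution α β g M := by
    -- The columns of `M` are relations among minimal generators, so their entries lie in the
    -- irrelevant ideal.
    refine ⟨hg, fun i j => hhom j i, fun i j => hg.relations (k j) (hker j) i, ?_, ?_⟩
    · intro c d hcd
      rw [hM, hM] at hcd
      exact hli.fintypeLinearCombination_injective hcd
    · intro v
      rw [← LinearMap.mem_ker, ← hspan, ← Fintype.range_linearCombination]
      exact exists_congr fun c => by rw [hM]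
  refine ⟨r, β, M, hres, ?_⟩
  have := card_eq_of_resolution hres.injective hres.exact (by
    rw [hg.span_eq]
    intro hbot
    rw [hbot, Ideal.height_bot] at hheight
    norm_num at hheight)
  simpa using this

/-- For `r = 0` the ideal would be principal and proper, against height two; for `r = 1` two
generators would make `Y` a complete intersection. -/
lemma IsResolution.two_le {r : ℕ} {α : Fin r ⊕ Unit → ℤ} {β : Fin r → ℤ}
    {g : Fin r ⊕ Unit → CoordRing n} {M : Matrix (Fin r ⊕ Unit) (Fin r) (CoordRing n)}
    (h : Y.IsResolution α β g M) (hheight : Y.ideal.toIdeal.height = 2)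
    (htop : Y.ideal.toIdeal ≠ ⊤) (hCI : ¬ Y.IsCompleteIntersection) : 2 ≤ r := by
  by_contra! hr
  obtain rfl | rfl : r = 0 ∨ r = 1 := by omega
  · refine not_le_span_singleton_of_two_le_height hheight.ge (q := g (Sum.inr ())) ?_ ?_
    · intro hu
      refine htop (Ideal.eq_top_of_isUnit_mem _ ?_ hu)
      rw [← h.minimal.span_eq]
      exact Ideal.subset_span ⟨_, rfl⟩
    · rw [← h.minimal.span_eq, Ideal.span_le]
      rintro _ ⟨i | i, rfl⟩
      · exact i.elim0
      · exact Ideal.subset_span rfl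
  · let e : Fin 2 ≃ Fin 1 ⊕ Unit := finSumFinEquiv.symm.trans
      (Equiv.sumCongr (Equiv.refl (Fin 1)) finOneEquiv)
    refine hCI ⟨2, hheight, g ∘ e, fun i => ?_, ?_⟩
    · exact (h.minimal.homogeneous (e i)).exists_isHomogeneous
    · rw [e.surjective.range_comp, h.minimal.span_eq]

end ClosedSubscheme

open ClosedSubscheme in
/-- The resolution of an arithmetically Cohen-Macaulay `Y` which is not a complete intersection,
according to whether `F` is a minimal generator. -/
theorem exists_resolution_of_isACM {d : ℕ} {F : CoordRing n} (hF : F.IsHomogeneous d)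
    (hF0 : F ≠ 0) {Y : ClosedSubscheme n} (hYX : Y.IsContainedIn F) (hcodim : Y.HasCodimOneIn F)
    {I : Type*} {T : I → WeakAdmissiblePair} (hT : HasExactlyTypes F T) (hACM : Y.IsACM)
    (hCI : ¬ Y.IsCompleteIntersection) :
    IsWeakDeterminantal F ∧
      ((Y.HasMinimalGenerator F ∧ ∃ (j : I) (k : ℤ),
        Y.HasMinimalFreeResolution
          (Sum.elim (fun i : Fin (T j).t => (T j).a i + k) (fun _ : Unit => (d : ℤ)))
          (fun i : Fin (T j).t => (T j).b i + k)) ∨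
      (¬ Y.HasMinimalGenerator F ∧ ∃ (j : I) (j₀ : Fin (T j).t),
        Y.HasMinimalFreeResolution
          (fun i : Fin (T j).t => (d : ℤ) - (T j).b j₀ + (T j).a i)
          (fun i : {i : Fin (T j).t // i ≠ j₀} => (d : ℤ) - (T j).b j₀ + (T j).b i.1))) := by
  classical
  have hFd := isHomogeneousOfDegree_natCast_iff.mpr hF
  obtain ⟨hheight, htop, Q, hQprime, hIQ, hQm, hQ⟩ := hcodim.height_and_exists hF0 hYX
  obtain ⟨s, α, g, hg⟩ := (isGradedIdeal_toIdeal Y.ideal).exists_isMinimalFamily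
  obtain ⟨c, hc, hFc⟩ := hg.exists_homogeneous_coeffs hFd hYX
  -- The two cases decide whether `F` is a minimal generator.
  by_cases hcm : ∀ i, c i ∈ irrelevantIdeal n
  · obtain ⟨r, β, M, hres, hcard⟩ :=
      hACM.exists_isResolution hheight hQprime hIQ hQm hQ hg
    let e : Fin r ⊕ Unit ≃ Fin s := Fintype.equivOfCardEq (by simpa using hcard.symm)
    replace hres := hres.reindex e (Equiv.refl _)
    have hr := hres.two_le hheight htop hCI
    obtain ⟨u, hu, huD⟩ := exists_isUnit_lastColumnDet_eq hres.injective hres.exact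
      (by rw [hres.minimal.span_eq, hheight])
    -- Hilbert–Burch evaluated at the column of coefficients of `F`; the matrix has size `r + 1`.
    have hdet : (Matrix.fromCols (M.submatrix e (Equiv.refl _))
        (Matrix.replicateCol Unit (c ∘ e))).det = u * F := by
      rw [← lastColumnDet_apply, huD, hFc]
      congr 1
      rw [Fintype.linearCombination_apply]
      exact Fintype.sum_equiv e _ _ fun i => rfl
    obtain ⟨hWD, j, k, σ, τ, ha, hb⟩ := hT.exists_equiv hF0 (by simp; omega)
      (a := α ∘ e) (b := Sum.elim β fun _ => d) (by
        rintro i (j | j)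
        · exact hres.homogeneous i j
        · exact hc _) (by
        rintro i (j | j)
        · exact hres.mem i j
        · exact hcm _) hu hdet
    refine ⟨hWD, Or.inr ⟨not_hasMinimalGenerator_of_mem_mul hFd ?_, j, τ.symm (Sum.inr ()), ?_⟩⟩
    · rw [hFc]
      refine Ideal.sum_mem _ fun i _ => Ideal.mul_mem_mul (hcm i) ?_
      rw [← hg.span_eq]
      exact Ideal.subset_span ⟨i, rfl⟩
    -- The added column has degree `d` and becomes column `j₀` of the sorted type, so the shift is
    -- `d - b_{j₀}`; deleting this column leaves the degrees of the syzygies.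
    · have hd : (d : ℤ) = (T j).b (τ.symm (Sum.inr ())) + k := by
        have := hb (τ.symm (Sum.inr ()))
        simpa using this
      let f : Fin r → {i : Fin (T j).t // i ≠ τ.symm (Sum.inr ())} := fun x =>
        ⟨τ.symm (Sum.inl x), fun h => by simpa using τ.symm.injective h⟩
      have hf : Function.Bijective f := by
        constructor
        · intro x y hxy
          have := τ.symm.injective (congrArg Subtype.val hxy)
          simpa using this
        · rintro ⟨i, hi⟩
          rcases hx : τ i with x | x
          · exact ⟨x, Subtype.ext (by simp [f, ← hx])⟩
          · exact absurd (by simp [← hx]) hi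
      refine (hres.reindex σ (Equiv.ofBijective f hf).symm).hasMinimalFreeResolution ?_ ?_
      · ext i
        have := ha i
        simp only [Function.comp_apply] at this ⊢
        omega
      · ext i
        obtain ⟨x, rfl⟩ := hf.surjective i
        have h1 : (Equiv.ofBijective f hf).symm (f x) = x := Equiv.ofBijective_symm_apply_apply f hf x
        have h2 := hb (τ.symm (Sum.inl x))
        simp only [Equiv.apply_symm_apply, Sum.elim_inl] at h2
        simp only [Function.comp_apply, h1, Equiv.refl_apply]
        change β x = (d : ℤ) - (T j).b (τ.symm (Sum.inr ())) + (T j).b (τ.symm (Sum.inl x))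
        omega
  · push Not at hcm
    obtain ⟨i₀, hi₀⟩ := hcm
    obtain ⟨hd, hg'⟩ := hg.update hFd hc hFc hi₀
    have hgen := hg'.hasMinimalGenerator i₀
    rw [Function.update_self] at hgen
    obtain ⟨r, β, M, hres, hcard⟩ :=
      hACM.exists_isResolution hheight hQprime hIQ hQm hQ hg'
    -- The generators are reindexed so that `F` occupies the extra row.
    obtain ⟨e, he⟩ : ∃ e : Fin r ⊕ Unit ≃ Fin s, e (Sum.inr ()) = i₀ := by
      let e : Fin r ⊕ Unit ≃ Fin s := Fintype.equivOfCardEq (by simpa using hcard.symm)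
      exact ⟨e.trans (Equiv.swap (e (Sum.inr ())) i₀), by simp⟩
    replace hres := hres.reindex e (Equiv.refl _)
    have hr := hres.two_le hheight htop hCI
    obtain ⟨u, hu, huD⟩ := exists_isUnit_lastColumnDet_eq hres.injective hres.exact
      (by rw [hres.minimal.span_eq, hheight])
    -- Hilbert–Burch at the basis vector of `F`: the matrix is block triangular, leaving the `r × r`
    -- minor without the row of `F`.
    have hdet : (M.submatrix (e ∘ Sum.inl) id).det = u * F := by
      have h1 := huD (Pi.single (Sum.inr ()) 1)
      rw [Fintype.linearCombination_apply_single, one_smul, Function.comp_apply, he,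
        Function.update_self, lastColumnDet_apply] at h1
      have h2 : Matrix.fromCols (M.submatrix e (Equiv.refl _))
          (Matrix.replicateCol Unit (Pi.single (Sum.inr ()) 1)) =
          Matrix.fromBlocks (M.submatrix (e ∘ Sum.inl) id) 0
            (M.submatrix (e ∘ Sum.inr) id) (1 : Matrix Unit Unit (CoordRing n)) := by
        ext (i | i) (j | j) <;> simp
      rw [← h1, h2, Matrix.det_fromBlocks_zero₁₂, Matrix.det_one, mul_one]
    obtain ⟨hWD, j, k, σ, τ, ha, hb⟩ := hT.exists_equiv hF0 (by simpa using hr)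
      (a := α ∘ e ∘ Sum.inl) (b := β) (fun i j => hres.homogeneous (Sum.inl i) j)
      (fun i j => hres.mem (Sum.inl i) j) hu hdet
    refine ⟨hWD, Or.inl ⟨hgen, j, k, ?_⟩⟩
    refine (hres.reindex (Equiv.sumCongr σ (Equiv.refl Unit)) τ).hasMinimalFreeResolution ?_ ?_
    · ext (i | i)
      · simpa using ha i
      · simp [he, hd]
    · ext i
      simpa using hb i

end Main
end ACMHypersurface
theorem mainTheorem9 {n d : ℕ} (F : ACMHypersurface.CoordRing n)
    (hF : F.IsHomogeneous d) (hF0 : F ≠ 0)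
    (Y : ACMHypersurface.ClosedSubscheme n)
    (hYX : Y.IsContainedIn F) (hcodim : Y.HasCodimOneIn F)
    {I : Type*} (T : I → ACMHypersurface.WeakAdmissiblePair)
    (hT : ACMHypersurface.HasExactlyTypes F T) :
    Y.IsACM ↔
      (¬ ACMHypersurface.IsWeakDeterminantal F ∧ Y.IsCompleteIntersection) ∨
      (ACMHypersurface.IsWeakDeterminantal F ∧
        (Y.IsCompleteIntersection ∨
         (¬ Y.IsCompleteIntersection ∧ Y.HasMinimalGenerator F ∧
            ∃ (j : I) (k : ℤ),
              Y.HasMinimalFreeResolution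
                (Sum.elim (fun i : Fin (T j).t => (T j).a i + k) (fun _ : Unit => (d : ℤ)))
                (fun i : Fin (T j).t => (T j).b i + k)) ∨
         (¬ Y.IsCompleteIntersection ∧ ¬ Y.HasMinimalGenerator F ∧
            ∃ (j : I) (j₀ : Fin (T j).t),
              Y.HasMinimalFreeResolution
                (fun i : Fin (T j).t => (d : ℤ) - (T j).b j₀ + (T j).a i)
                (fun i : {i : Fin (T j).t // i ≠ j₀} =>
                  (d : ℤ) - (T j).b j₀ + (T j).b i.1)))) := by
  obtain ⟨hheight, -, -⟩ := hcodim.height_and_exists hF0 hYX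
  constructor
  · intro hACM
    by_cases hCI : Y.IsCompleteIntersection
    · by_cases hWD : ACMHypersurface.IsWeakDeterminantal F
      · exact Or.inr ⟨hWD, Or.inl hCI⟩
      · exact Or.inl ⟨hWD, hCI⟩
    · obtain ⟨hWD, h | h⟩ :=
        ACMHypersurface.exists_resolution_of_isACM hF hF0 hYX hcodim hT hACM hCI
      · exact Or.inr ⟨hWD, Or.inr (Or.inl ⟨hCI, h⟩)⟩
      · exact Or.inr ⟨hWD, Or.inr (Or.inr ⟨hCI, h⟩)⟩
  · rintro (⟨-, hCI⟩ | ⟨-, hCI | ⟨-, -, j, k, hres⟩ | ⟨-, -, j, j₀, hres⟩⟩)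
    · exact hCI.isACM hheight
    · exact hCI.isACM hheight
    · exact hres.isACM hheight
    · exact hres.isACM hheight
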